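/- Let $E$ be a countable (finite or infinite) set and let $Q=(Q(i,j))_{i,j\in E}$ be a conservative $Q$-matrix on $E$ (real entries, $Q(i,j)\ge 0$ for $i\neq j$, $\sum_{j}Q(i,j)=0$ for all $i$) that is uniformly bounded: $\sup_{i\in E}(-Q(i,i))<\infty$. Let $(P_t)_{t\ge 0}$ be an honest standard transition function on $E$ with $Q$-matrix $Q$, i.e. $\lim_{t\to 0^+}(P_t(i,j)-\delta_{ij})/t=Q(i,j)$ for all $i,j\in E$, and suppose that it is irreducible and has an invariant probability distribution $\pi$, i.e. $\sum_i\pi(i)P_t(i,j)=\pi(j)$ for all $t\ge0$, $j\in E$ (reversibility is not assumed). Let $\mathcal A$, with domain $\mathcal D(\mathcal A)$, be the infinitesimal generator of $P_tf(i)=\sum_jP_t(i,j)f(j)$ on $L^2(\pi)$, so that $\mathcal A f=\lim_{t\to0^+}(P_tf-f)/t$ in $L^2(\pi)$. With $\pi(f)=\sum_i\pi(i)f(i)$, $\langle f,h\rangle_\pi=\pi(fh)$ and $\|f\|_{\pi,2}=\pi(f^2)^{1/2}$, put $$\lambda(Q)=\inf\{-\langle\mathcal A f,f\rangle_\pi :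 f\in\mathcal D(\mathcal A),\ \|f\|_{\pi,2}=1,\ \pi(f)=0\},$$ and assume that $\lambda(Q)>0$, i.e. that the chain admits an $L^2(\pi)$-spectral gap. Let $(X_t)_{t\ge0}$ be a continuous-time Markov chain on $E$ with right-continuous paths, transition function $(P_t)$ and initial distribution $\pi$, and let $\mathbb P_\pi$ denote its probability measure. Then for all real $a<b$, every $g:E\to[a,b]$, and all $t,\varepsilon>0$, $$\mathbb P_\pi\left(\frac1t\int_0^t g(X_s)\,ds-\pi(g)\ge\varepsilon\right)\le\exp\left\{-\frac{\lambda(Q)\,t\,\varepsilon^2}{(b-a)^2}\right\}.$$ (If $E$ has a single point, then $\lambda(Q)=\inf\emptyset=+\infty$ and the right-hand side is read as $0$.) -/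

import Mathlib

open MeasureTheory Filter Topology
open scoped NNReal ENNReal

namespace HoeffdingCTMC

/-- A totally stable and conservative `Q`-matrix on `E`: finite real entries, nonnegative off the
diagonal, with absolutely convergent rows of sum zero. -/
structure IsQMatrix {E : Type*} (Q : E → E → ℝ) : Prop where
  nonneg_offDiag : ∀ i j, i ≠ j → 0 ≤ Q i j
  conservative : ∀ i, HasSum (Q i) 0

/-- The `Q`-matrix is uniformly bounded: `sup_i (-Q(i,i)) < ∞`. -/
def UniformlyBounded {E : Type*} (Q : E → E → ℝ) : Prop :=
  BddAbove (Set.range fun i => -Q i i)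

/-- An (honest, standard) transition function `P t i j = P_t(i,j)` on `E`. -/
structure IsTransitionFunction {E : Type*} (P : ℝ≥0 → E → E → ℝ) : Prop where
  nonneg : ∀ t i j, 0 ≤ P t i j
  row_sum : ∀ t i, HasSum (P t i) 1
  zero_self : ∀ i, P 0 i i = 1
  chapman_kolmogorov : ∀ s t i j, HasSum (fun k => P s i k * P t k j) (P (s + t) i j)
  standard : ∀ i, Tendsto (fun t => P t i i) (𝓝[>] 0) (𝓝 1)

/-- `P` is a `Q`-process: a transition function whose entrywise right derivative at time zero
is `Q`. (The initial value `P 0` is the identity matrix, written here through `P 0 i j`.) -/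
structure IsQProcess {E : Type*} (Q : E → E → ℝ) (P : ℝ≥0 → E → E → ℝ) : Prop where
  isTransitionFunction : IsTransitionFunction P
  deriv_zero : ∀ i j, Tendsto (fun t : ℝ≥0 => (P t i j - P 0 i j) / (t : ℝ)) (𝓝[>] 0) (𝓝 (Q i j))

/-- Irreducibility: every state can be reached from every state. -/
def IsIrreducible {E : Type*} (P : ℝ≥0 → E → E → ℝ) : Prop :=
  ∀ i j, ∃ t : ℝ≥0, 0 < t ∧ 0 < P t i j

/-- The measure `π` is invariant for `P`: `∑_i π(i) P_t(i,j) = π(j)`. -/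
def IsInvariant {E : Type*} [MeasurableSpace E] (P : ℝ≥0 → E → E → ℝ) (π : Measure E) : Prop :=
  ∀ t j, HasSum (fun i => π.real {i} * P t i j) (π.real {j})

/-- The action on functions: `(P_t f)(i) = ∑_j P_t(i,j) f(j)`. -/
noncomputable def act {E : Type*} (P : ℝ≥0 → E → E → ℝ) (t : ℝ≥0) (f : E → ℝ) : E → ℝ :=
  fun i => ∑' j, P t i j * f j

/-- The graph of the infinitesimal generator `𝓐` of `P` on `L²(π)`: `f ∈ D(𝓐)` and `𝓐 f = h`,
that is, `f, h ∈ L²(π)` and `(P_t f - f) / t → h` in `L²(π)` as `t → 0+`. -/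
structure GeneratorGraph {E : Type*} [MeasurableSpace E] (P : ℝ≥0 → E → E → ℝ) (π : Measure E)
    (f h : E → ℝ) : Prop where
  memLp_fun : MemLp f 2 π
  memLp_image : MemLp h 2 π
  tendsto : Tendsto
    (fun t : ℝ≥0 => eLpNorm (fun i => (act P t f i - f i) / (t : ℝ) - h i) 2 π) (𝓝[>] 0) (𝓝 0)

/-- `inf { -⟨𝓐 f, f⟩_π : f ∈ D(𝓐), ‖f‖_{π,2} = 1, π(f) = 0 }`, as an extended real number, so that
the infimum of the empty set (which occurs when `E` is a single point) is `+∞`. -/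
noncomputable def spectralGap {E : Type*} [MeasurableSpace E] (P : ℝ≥0 → E → E → ℝ)
    (π : Measure E) : EReal :=
  sInf {r : EReal | ∃ f h : E → ℝ, GeneratorGraph P π f h ∧ eLpNorm f 2 π = 1 ∧
    ∫ i, f i ∂π = 0 ∧ r = ((-∫ i, h i * f i ∂π : ℝ) : EReal)}

/-- Under the probability measure `μ` on `Ω`, the process `X` is a time-homogeneous continuous-time
Markov chain with transition function `P` and initial distribution `π`: its finite-dimensional
distributions are `π(i₀) P_{t₁-t₀}(i₀,i₁) ⋯ P_{tₙ-tₙ₋₁}(iₙ₋₁,iₙ)` for `0 = t₀ ≤ t₁ ≤ ⋯ ≤ tₙ`, and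
almost all paths are right-continuous for the discrete topology of `E`. -/
structure IsMarkovChain {E Ω : Type*} [MeasurableSpace E] [MeasurableSpace Ω]
    (P : ℝ≥0 → E → E → ℝ) (π : Measure E) (μ : Measure Ω) (X : ℝ≥0 → Ω → E) : Prop where
  measurable : ∀ t, Measurable (X t)
  finite_dim : ∀ (n : ℕ) (τ : ℕ → ℝ≥0) (i : ℕ → E), τ 0 = 0 → Monotone τ →
    μ.real {ω | ∀ k ≤ n, X (τ k) ω = i k} =
      π.real {i 0} * ∏ k ∈ Finset.range n, P (τ (k + 1) - τ k) (i k) (i (k + 1))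
  right_continuous : ∀ᵐ ω ∂μ, ∀ t, ∀ᶠ s in 𝓝[≥] t, X s ω = X t ω

end HoeffdingCTMC

/-! Chernoff's method reduces the claim to `E exp(∫₀ᵗ V(X_s) ds) ≤ exp(t (b-a)²/(4l))` for centred
`V` with values in `[a, b]` and `0 < l ≤ λ(Q)` (`lintegral_exp_additive_le`). The left side is
governed by the Feynman–Kac semigroup generated by `𝓐 + V`, whose `L²(π)` growth rate is at most the
supremum of `⟨(𝓐 + V)h, h⟩` over unit vectors `h`. Only the quadratic form of `𝓐` enters, so
reversibility plays no role. The gap gives `⟨𝓐h, h⟩ ≤ -l Var(h)`, leaving a rank-one problem for `V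
+ l(π - 1)`. Cauchy–Schwarz with weight `θ - V` and a chord bound for `x ↦ 1/(θ - x)` solve it
(`mul_sq_integral_le`).

The semigroup is handled in discrete time. Bounded `Q` makes `P_t - 1` of operator norm `O(t)`, so
`𝓐` is bounded and `‖P_δ h‖²` has a first-order expansion with error `O(δ²)`
(`exists_integral_sq_act_le`). With `δ = t/n` the errors accumulate to `O(1/n)` in the exponent, and
Fatou's lemma passes from Riemann sums to the path integral. -/

namespace HoeffdingCTMC

/-! ### Summation tools and elementary bounds for transition functions. -/

/-- Exchange of the order of summation for a nonnegative kernel `K` with `w K = v`. -/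
lemma hasSum_mul_tsum_of_hasSum {α β : Type*} {w : α → ℝ} {K : α → β → ℝ} {v : β → ℝ}
    (hw : ∀ i, 0 ≤ w i) (hK : ∀ i j, 0 ≤ K i j) (h : ∀ j, HasSum (fun i => w i * K i j) (v j))
    {F : β → ℝ} (hF : Summable fun j => v j * |F j|) :
    (∀ i, w i ≠ 0 → Summable fun j => K i j * F j) ∧
      HasSum (fun i => w i * ∑' j, K i j * F j) (∑' j, v j * F j) := by
  have hG : Summable fun p : β × α => w p.2 * K p.2 p.1 * F p.1 := by
    refine Summable.of_abs ?_
    have hnn : (0 : β × α → ℝ) ≤ fun p => |w p.2 * K p.2 p.1 * F p.1| := fun p => abs_nonneg _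
    have habs : ∀ j i, |w i * K i j * F j| = w i * K i j * |F j| := fun j i => by
      rw [abs_mul, abs_of_nonneg (mul_nonneg (hw i) (hK i j))]
    refine (summable_prod_of_nonneg hnn).2 ⟨fun j => ?_, ?_⟩
    · simpa only [habs] using ((h j).mul_right |F j|).summable
    · simpa only [habs, ((h _).mul_right _).tsum_eq] using hF
  have hS := hG.hasSum
  have h1 := hS.prod_fiberwise (fun j => (h j).mul_right (F j))
  have hG' : Summable fun p : α × β => w p.1 * K p.1 p.2 * F p.2 := hG.prod_symm
  have hS' : HasSum (fun p : α × β => w p.1 * K p.1 p.2 * F p.2) (∑' j, v j * F j) := by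
    rw [h1.tsum_eq]
    exact (Equiv.prodComm α β).hasSum_iff.2 hS
  refine ⟨fun i hi => ?_, ?_⟩
  · have h2 := hG'.prod_factor i
    simp only [mul_assoc] at h2
    exact (summable_mul_left_iff hi).1 h2
  · refine hS'.prod_fiberwise (fun i => ?_)
    have h2 := (hG'.prod_factor i).hasSum
    simp only [mul_assoc, tsum_mul_left] at h2
    simpa only [mul_assoc] using h2

lemma integrable_iff_summable_real_singleton {E : Type*} [Countable E] [MeasurableSpace E]
    [DiscreteMeasurableSpace E] {π : Measure E} [IsFiniteMeasure π] {f : E → ℝ} :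
    Integrable f π ↔ Summable fun i => π.real {i} * |f i| := by
  have h := integrable_sum_dirac_iff (X := E) (x := fun i : E => i) (c := fun i => π {i}) (f := f)
    (fun i => measure_ne_top _ _)
  rw [Measure.sum_smul_dirac] at h
  exact h

namespace IsTransitionFunction

variable {E : Type*} {P : ℝ≥0 → E → E → ℝ}

lemma le_one (hP : IsTransitionFunction P) (t : ℝ≥0) (i j : E) : P t i j ≤ 1 :=
  le_hasSum (hP.row_sum t i) j fun k _ => hP.nonneg t i k

lemma summable_mul_of_sq (hP : IsTransitionFunction P) {t : ℝ≥0} {i : E} {f : E → ℝ}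
    (hf : Summable fun j => P t i j * f j ^ 2) : Summable fun j => P t i j * f j := by
  refine Summable.of_norm_bounded ((hP.row_sum t i).summable.add hf) fun j => ?_
  rw [Real.norm_eq_abs, abs_mul, abs_of_nonneg (hP.nonneg t i j)]
  nlinarith [hP.nonneg t i j, sq_abs (f j), sq_nonneg (|f j| - 1)]

lemma pow_le_diag (hP : IsTransitionFunction P) (t : ℝ≥0) (i : E) (n : ℕ) :
    P t i i ^ n ≤ P (n * t) i i := by
  induction n with
  | zero => simp [hP.zero_self]
  | succ n ih =>
    have h := le_hasSum (hP.chapman_kolmogorov (n * t) t i i) i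
      fun k _ => mul_nonneg (hP.nonneg _ _ _) (hP.nonneg _ _ _)
    calc P t i i ^ (n + 1) = P t i i ^ n * P t i i := pow_succ _ _
      _ ≤ P (n * t) i i * P t i i := by gcongr; exact hP.nonneg _ _ _
      _ ≤ P (n * t + t) i i := h
      _ = _ := by congr 1; push_cast; ring

end IsTransitionFunction

/-- The exit probabilities of a `Q`-process are at most linear in time. -/
lemma IsQProcess.one_sub_diag_le {E : Type*} {Q : E → E → ℝ} {P : ℝ≥0 → E → E → ℝ}
    (hP : IsQProcess Q P) (t : ℝ≥0) (i : E) : 1 - P t i i ≤ -Q i i * t := by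
  have hT := hP.isTransitionFunction
  rcases eq_or_ne t 0 with rfl | ht
  · rw [hT.zero_self]; simp
  have ht' : 0 < t := pos_iff_ne_zero.2 ht
  have hu : Tendsto (fun n : ℕ => t / ((n : ℝ≥0) + 1)) atTop (𝓝[>] 0) := by
    refine tendsto_nhdsWithin_iff.2 ⟨?_, Eventually.of_forall fun n => ?_⟩
    · rw [← NNReal.tendsto_coe]
      have h := (tendsto_one_div_add_atTop_nhds_zero_nat (𝕜 := ℝ)).const_mul (t : ℝ)
      rw [mul_zero] at h
      refine h.congr fun n => ?_
      push_cast
      ring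
    · exact div_pos ht' (by positivity)
  have h1 := ((hP.deriv_zero i i).comp hu).const_mul (t : ℝ)
  have h2 : ∀ n : ℕ, (t : ℝ) * (((P (t / ((n : ℝ≥0) + 1)) i i - P 0 i i)
      / (t / ((n : ℝ≥0) + 1) : ℝ≥0))) ≤ P t i i - 1 := fun n => by
    -- Bernoulli's inequality for `P_t(i,i) ≥ P_{t/(n+1)}(i,i)^(n+1)`; the limit in `n` produces `t
    -- Q(i,i)`.
    have hb := one_add_mul_le_pow (a := P (t / ((n : ℝ≥0) + 1)) i i - 1)
      (by linarith [hT.nonneg (t / ((n : ℝ≥0) + 1)) i i]) (n + 1)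
    have hp := hT.pow_le_diag (t / ((n : ℝ≥0) + 1)) i (n + 1)
    have he : ((n + 1 : ℕ) : ℝ≥0) * (t / ((n : ℝ≥0) + 1)) = t := by
      push_cast; field_simp
    rw [he] at hp
    rw [add_sub_cancel] at hb
    have ht0 : (t : ℝ) ≠ 0 := by exact_mod_cast ht
    have : (t : ℝ) * (((P (t / ((n : ℝ≥0) + 1)) i i - P 0 i i)
      / (t / ((n : ℝ≥0) + 1) : ℝ≥0))) = ((n + 1 : ℕ) : ℝ) * (P (t / ((n : ℝ≥0) + 1)) i i - 1) := by
      rw [hT.zero_self]; push_cast; field_simp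
    rw [this]
    linarith
  have := le_of_tendsto' h1 h2
  linarith

end HoeffdingCTMC

/-! ### The transition operators on `L²(π)`. -/

namespace HoeffdingCTMC

/-- With every state charged, classes in `Lp` are genuine functions and identities may be checked
pointwise. -/
lemma ae_iff_forall_of_real_singleton_pos {α : Type*} [Countable α] [MeasurableSpace α]
    {π : Measure α} (hpos : ∀ i, 0 < π.real {i}) {p : α → Prop} :
    (∀ᵐ i ∂π, p i) ↔ ∀ i, p i := by
  rw [ae_iff_of_countable]
  refine forall_congr' fun i => ⟨fun h => h fun h0 => ?_, fun h _ => h⟩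
  have := hpos i
  simp [Measure.real, h0] at this

lemma norm_sq_eq_integral_sq {α : Type*} [MeasurableSpace α] {π : Measure α}
    (f : Lp ℝ 2 π) : ‖f‖ ^ 2 = ∫ i, f i ^ 2 ∂π := by
  rw [← real_inner_self_eq_norm_sq, L2.inner_def]
  simp [sq]

variable {E : Type*} [Countable E] [MeasurableSpace E] [DiscreteMeasurableSpace E]
  {P : ℝ≥0 → E → E → ℝ} {π : Measure E}

/-- An invariant distribution of an irreducible chain charges every state. -/
lemma IsInvariant.real_singleton_pos [IsProbabilityMeasure π] (hP : IsTransitionFunction P)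
    (hirr : IsIrreducible P) (hπ : IsInvariant P π) (j : E) : 0 < π.real {j} := by
  obtain ⟨i, hi⟩ : ∃ i, π {i} ≠ 0 := by
    by_contra! h
    have h1 : ∑' i, π {i} = 1 := by
      have h2 := lintegral_countable' (μ := π) fun _ => 1
      simpa using h2.symm
    simp [h] at h1
  have hi' : 0 < π.real {i} := (measureReal_nonneg).lt_of_ne'
    ((measureReal_ne_zero_iff (measure_ne_top _ _)).2 hi)
  obtain ⟨t, -, ht⟩ := hirr i j
  exact (mul_pos hi' ht).trans_le
    (le_hasSum (hπ t j) i fun k _ => mul_nonneg measureReal_nonneg (hP.nonneg _ _ _))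

section Invariant

variable [IsProbabilityMeasure π] (hP : IsTransitionFunction P) (hπ : IsInvariant P π)
  (hpos : ∀ i, 0 < π.real {i})

include hP hπ

lemma integrable_act {f : E → ℝ} (hf : Integrable f π) (t : ℝ≥0) : Integrable (act P t f) π := by
  have h := (hasSum_mul_tsum_of_hasSum (fun _ => measureReal_nonneg) (hP.nonneg t) (hπ t)
    (integrable_iff_summable_real_singleton.1 hf)).2
  rw [integrable_iff_summable_real_singleton]
  exact h.summable.abs.congr fun i => by rw [abs_mul, abs_of_nonneg measureReal_nonneg, act]

lemma integral_act {f : E → ℝ} (hf : Integrable f π) (t : ℝ≥0) :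
    ∫ i, act P t f i ∂π = ∫ i, f i ∂π := by
  rw [integral_countable (integrable_act hP hπ hf t), integral_countable hf]
  exact (hasSum_mul_tsum_of_hasSum (fun _ => measureReal_nonneg) (hP.nonneg t) (hπ t)
    (integrable_iff_summable_real_singleton.1 hf)).2.tsum_eq

include hpos

lemma summable_mul_of_integrable {f : E → ℝ} (hf : Integrable f π) (t : ℝ≥0) (i : E) :
    Summable fun j => P t i j * f j :=
  (hasSum_mul_tsum_of_hasSum (fun _ => measureReal_nonneg) (hP.nonneg t) (hπ t)
    (integrable_iff_summable_real_singleton.1 hf)).1 i (hpos i).ne'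

/-- Chapman–Kolmogorov says that the kernel `P t` maps the row `P s i` to the row `P (s + t) i`, so
the exchange lemma applies with that row as weight. -/
lemma act_act {f : E → ℝ} (hf : Integrable f π) (s t : ℝ≥0) :
    act P s (act P t f) = act P (s + t) f := by
  funext i
  exact (hasSum_mul_tsum_of_hasSum (hP.nonneg s i) (hP.nonneg t) (hP.chapman_kolmogorov s t i)
    (summable_mul_of_integrable hP hπ hpos hf.abs (s + t) i)).2.tsum_eq

/-- Cauchy–Schwarz over the jumps `j ≠ i`, of total mass `1 - P t i i`, in discriminant form.
Keeping `P_t f² - f²` on the right matters: it has `π`-integral zero, so the `L²` bound is linear in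
`r` and not of order `√r`. -/
lemma sq_act_sub_le {f : E → ℝ} (hf : Integrable (fun i => f i ^ 2) π) {t : ℝ≥0} {i : E} {r : ℝ}
    (hr : 1 - P t i i ≤ r) :
    (act P t f i - f i) ^ 2 ≤
      2 * r * (act P t (fun j => f j ^ 2) i - f i ^ 2) + 4 * r ^ 2 * f i ^ 2 := by
  have h2 := summable_mul_of_integrable hP hπ hpos hf t i
  have h1 := hP.summable_mul_of_sq h2
  set m := act P t f i with hm
  set q := act P t (fun j => f j ^ 2) i with hq
  -- The sum `∑_j P_t(i,j) (f(j) - f(i) + y)²` dominates its diagonal term `P_t(i,i) y²`.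
  have key : ∀ y : ℝ, 0 ≤ (1 - P t i i) * (y * y) + 2 * (m - f i) * y
      + (q - f i ^ 2 - 2 * f i * (m - f i)) := fun y => by
    have hs : HasSum (fun j => P t i j * (f j - (f i - y)) ^ 2)
        (q - 2 * (f i - y) * m + (f i - y) ^ 2) := by
      convert! (h2.hasSum.sub (h1.hasSum.mul_left (2 * (f i - y)))).add
        ((hP.row_sum t i).mul_left ((f i - y) ^ 2)) using 1
      · funext j; ring
      · rw [hm, hq, act, act]; ring
    have h3 := le_hasSum hs i fun j _ => mul_nonneg (hP.nonneg t i j) (sq_nonneg _)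
    nlinarith [h3]
  have hd := discrim_le_zero key
  have hD := key 0
  rw [discrim] at hd
  have h4 : (m - f i) ^ 2 ≤ r * (q - f i ^ 2 - 2 * f i * (m - f i)) := by
    have : (1 - P t i i) * (q - f i ^ 2 - 2 * f i * (m - f i)) ≤
        r * (q - f i ^ 2 - 2 * f i * (m - f i)) :=
      mul_le_mul_of_nonneg_right hr (by linarith)
    linarith
  nlinarith [sq_nonneg (m - f i + 2 * r * f i)]

lemma memLp_act_sub {f : E → ℝ} (hf : MemLp f 2 π) {t : ℝ≥0} {r : ℝ}
    (hr : ∀ i, 1 - P t i i ≤ r) :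
    MemLp (fun i => act P t f i - f i) 2 π ∧
      ∫ i, (act P t f i - f i) ^ 2 ∂π ≤ (2 * r) ^ 2 * ∫ i, f i ^ 2 ∂π := by
  have hf2 : Integrable (fun i => f i ^ 2) π := hf.integrable_sq
  have hb₁ : Integrable (fun i => 2 * r * (act P t (fun j => f j ^ 2) i - f i ^ 2)) π :=
    ((integrable_act hP hπ hf2 t).sub hf2).const_mul _
  have hb₂ : Integrable (fun i => 4 * r ^ 2 * f i ^ 2) π := hf2.const_mul _
  have hb : Integrable (fun i => 2 * r * (act P t (fun j => f j ^ 2) i - f i ^ 2)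
      + 4 * r ^ 2 * f i ^ 2) π := hb₁.add hb₂
  have hle := fun i => sq_act_sub_le hP hπ hpos hf2 (hr i)
  have hi : Integrable (fun i => (act P t f i - f i) ^ 2) π := by
    refine hb.mono' (measurable_of_countable _).aestronglyMeasurable (Eventually.of_forall fun i => ?_)
    rw [Real.norm_of_nonneg (sq_nonneg _)]
    exact hle i
  refine ⟨(memLp_two_iff_integrable_sq (measurable_of_countable _).aestronglyMeasurable).2 hi, ?_⟩
  refine (integral_mono hi hb hle).trans_eq ?_
  rw [integral_add hb₁ hb₂,
    integral_const_mul, integral_const_mul, integral_sub (integrable_act hP hπ hf2 t) hf2,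
    integral_act hP hπ hf2 t]
  ring

/-- The transition function as a family of bounded operators on `L²(π)`. -/
lemma exists_clm_act {c : ℝ} (hc : ∀ t i, 1 - P t i i ≤ c * (t : ℝ)) :
    ∃ T : ℝ≥0 → Lp ℝ 2 π →L[ℝ] Lp ℝ 2 π, (∀ t f i, T t f i = act P t f i) ∧
      ∀ t, ‖T t - 1‖ ≤ 2 * c * t := by
  have hae := fun {p : E → Prop} => ae_iff_forall_of_real_singleton_pos (p := p) hpos
  obtain ⟨i₀⟩ : Nonempty E := nonempty_of_isProbabilityMeasure π
  have hc0 : ∀ t : ℝ≥0, 0 ≤ c * t := fun t => le_trans (by linarith [hP.le_one t i₀ i₀]) (hc t i₀)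
  have hm := fun (t : ℝ≥0) (f : Lp ℝ 2 π) => memLp_act_sub hP hπ hpos (Lp.memLp f) (hc t)
  have hsum : ∀ (t : ℝ≥0) (f : Lp ℝ 2 π) i, Summable fun j => P t i j * f j := fun t f i =>
    summable_mul_of_integrable hP hπ hpos ((Lp.memLp f).integrable (by norm_num)) t i
  -- `L t` is `P_t - 1`, the operator that the preceding estimate controls; the identity is added
  -- back below.
  let L : ℝ≥0 → Lp ℝ 2 π →ₗ[ℝ] Lp ℝ 2 π := fun t =>
    { toFun := fun f => (hm t f).1.toLp
      map_add' := fun f g => by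
        ext1
        have h1 := hae.1 (hm t (f + g)).1.coeFn_toLp
        have h2 := hae.1 (hm t f).1.coeFn_toLp
        have h3 := hae.1 (hm t g).1.coeFn_toLp
        have h4 := hae.1 (Lp.coeFn_add f g)
        have h5 := hae.1 (Lp.coeFn_add (hm t f).1.toLp (hm t g).1.toLp)
        refine hae.2 fun i => ?_
        rw [h1, h5, Pi.add_apply, h2, h3]
        simp only [act, h4, Pi.add_apply, mul_add]
        rw [(hsum t f i).tsum_add (hsum t g i)]
        ring
      map_smul' := fun a f => by
        ext1
        have h1 := hae.1 (hm t (a • f)).1.coeFn_toLp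
        have h2 := hae.1 (hm t f).1.coeFn_toLp
        have h4 := hae.1 (Lp.coeFn_smul a f)
        have h5 := hae.1 (Lp.coeFn_smul a (hm t f).1.toLp)
        refine hae.2 fun i => ?_
        rw [h1, RingHom.id_apply, h5, Pi.smul_apply, h2]
        simp only [act, h4, Pi.smul_apply, smul_eq_mul, mul_left_comm _ a, tsum_mul_left]
        ring }
  have hL : ∀ t f, ‖L t f‖ ≤ 2 * (c * t) * ‖f‖ := fun t f => by
    refine le_of_sq_le_sq ?_ (mul_nonneg (mul_nonneg zero_le_two (hc0 t)) (norm_nonneg f))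
    rw [mul_pow, norm_sq_eq_integral_sq, norm_sq_eq_integral_sq]
    refine le_trans (le_of_eq (integral_congr_ae ?_)) (hm t f).2
    filter_upwards [(hm t f).1.coeFn_toLp] with i hi
    simp only [L, LinearMap.coe_mk, AddHom.coe_mk, hi]
  refine ⟨fun t => 1 + (L t).mkContinuous _ (hL t), fun t f i => ?_, fun t => ?_⟩
  · have h1 := hae.1 (hm t f).1.coeFn_toLp
    have h2 := hae.1 (Lp.coeFn_add f (hm t f).1.toLp) i
    simp only [Pi.add_apply, h1] at h2
    have : (1 + (L t).mkContinuous _ (hL t)) f = f + (hm t f).1.toLp := rfl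
    rw [this, h2]
    ring
  · rw [add_sub_cancel_left, mul_assoc]
    exact LinearMap.mkContinuous_norm_le _ (mul_nonneg zero_le_two (hc0 t)) _

end Invariant

end HoeffdingCTMC

/-! ### Bounded generators and short-time expansions in Hilbert space. -/

namespace HoeffdingCTMC

section Semigroup

variable {𝔸 : Type*} [NormedRing 𝔸] [NormedAlgebra ℝ 𝔸] {T : ℝ≥0 → 𝔸} {C : ℝ}

/-- Each induction step adds `(T (m u) - 1)(T u - 1)`, of norm at most `C² m u²`. -/
lemma norm_nat_mul_sub_le (hadd : ∀ s t, T (s + t) = T s * T t) (hT : ∀ t, ‖T t - 1‖ ≤ C * t)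
    (m : ℕ) (u : ℝ≥0) : ‖T (m * u) - 1 - (m : ℝ) • (T u - 1)‖ ≤ C ^ 2 * (m * u) ^ 2 := by
  induction m with
  | zero => simpa using hT 0
  | succ m ih =>
    have h1 : T ((m + 1 : ℕ) * u) - 1 - ((m + 1 : ℕ) : ℝ) • (T u - 1) =
        (T (m * u) - 1 - (m : ℝ) • (T u - 1)) + (T (m * u) - 1) * (T u - 1) := by
      have : ((m + 1 : ℕ) : ℝ≥0) * u = m * u + u := by push_cast; ring
      rw [this, hadd]
      push_cast
      rw [add_smul, one_smul]
      noncomm_ring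
    have h2 : ‖(T (m * u) - 1) * (T u - 1)‖ ≤ C * (m * u) * (C * u) := by
      have h3 : ‖T (m * u) - 1‖ ≤ C * (m * u) := by simpa using hT (m * u)
      exact (norm_mul_le _ _).trans
        (mul_le_mul h3 (hT u) (norm_nonneg _) ((norm_nonneg _).trans h3))
    rw [h1]
    refine (norm_add_le _ _).trans ((add_le_add ih h2).trans ?_)
    push_cast
    have : 0 ≤ C ^ 2 * u ^ 2 * (m + 1 : ℝ) := by positivity
    nlinarith

/-- A semigroup that is Lipschitz at zero has a bounded generator, with a second-order bound on the
remainder. -/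
lemma exists_generator_of_norm_sub_one_le [CompleteSpace 𝔸]
    (hadd : ∀ s t, T (s + t) = T s * T t) (hT : ∀ t, ‖T t - 1‖ ≤ C * t) :
    ∃ A : 𝔸, ∀ t : ℝ≥0, ‖T t - 1 - (t : ℝ) • A‖ ≤ C ^ 2 * t ^ 2 := by
  let u : ℕ → ℝ≥0 := fun n => (2 ^ n)⁻¹
  let B : ℕ → 𝔸 := fun n => (2 ^ n : ℝ) • (T (u n) - 1)
  -- The dyadic difference quotients are Cauchy; the bound is `C² / 2 ^ n`, in the shape
  -- `cauchySeq_of_le_geometric_two` expects.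
  have hB : ∀ n, dist (B n) (B (n + 1)) ≤ 2 * C ^ 2 / 2 / 2 ^ n := fun n => by
    have h := norm_nat_mul_sub_le hadd hT 2 (u (n + 1))
    have h1 : ((2 : ℕ) : ℝ≥0) * u (n + 1) = u n := by
      simp only [u, pow_succ]; push_cast; field_simp
    have h2 : ((2 : ℕ) : ℝ) * (u (n + 1) : ℝ) = (2 ^ n)⁻¹ := by
      rw [← NNReal.coe_natCast, ← NNReal.coe_mul, h1]; simp [u]
    rw [h1, h2] at h
    have h3 : B n - B (n + 1) = (2 ^ n : ℝ) • (T (u n) - 1 - ((2 : ℕ) : ℝ) • (T (u (n + 1)) - 1)) := by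
      simp only [B, smul_sub, smul_smul, pow_succ]
      push_cast
      abel
    rw [dist_eq_norm, h3, norm_smul, Real.norm_of_nonneg (by positivity)]
    calc (2 : ℝ) ^ n * _ ≤ 2 ^ n * (C ^ 2 * ((2 ^ n)⁻¹) ^ 2) := by gcongr
      _ = _ := by field_simp
  obtain ⟨A, hA⟩ := cauchySeq_tendsto_of_complete (cauchySeq_of_le_geometric_two hB)
  refine ⟨A, fun t => ?_⟩
  -- Dyadic approximation of `t` from below, so that `T t` factors through `T (m n * u n)`.
  let m : ℕ → ℕ := fun n => ⌊(t : ℝ) * 2 ^ n⌋₊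
  have hmu : ∀ n, ((m n * u n : ℝ≥0) : ℝ) = ⌊(t : ℝ) * 2 ^ n⌋₊ / 2 ^ n := fun n => by
    simp [m, u, div_eq_mul_inv]
  have hle : ∀ n, m n * u n ≤ t := fun n => by
    rw [← NNReal.coe_le_coe, hmu, div_le_iff₀ (by positivity)]
    exact Nat.floor_le (by positivity)
  have hlim : Tendsto (fun n => ((m n * u n : ℝ≥0) : ℝ)) atTop (𝓝 t) := by
    simp only [hmu]
    exact (tendsto_nat_floor_mul_div_atTop t.coe_nonneg).comp
      (tendsto_pow_atTop_atTop_of_one_lt one_lt_two)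
  have hTlim : Tendsto (fun n => T (m n * u n)) atTop (𝓝 (T t)) := by
    rw [tendsto_iff_norm_sub_tendsto_zero]
    have hC : 0 ≤ C := by simpa using (norm_nonneg _).trans (hT 1)
    have hz : Tendsto (fun n => (1 + C * t) * (C * ((t : ℝ) - ((m n * u n : ℝ≥0) : ℝ)))) atTop (𝓝 0) := by
      have := (((tendsto_const_nhds (x := (t : ℝ))).sub hlim).const_mul C).const_mul (1 + C * t)
      simpa using this
    refine squeeze_zero (fun _ => norm_nonneg _) (fun n => ?_) hz
    have h1 : T (m n * u n) - T t = -((T (t - m n * u n) - 1)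
        + (T (m n * u n) - 1) * (T (t - m n * u n) - 1)) := by
      conv_lhs => rw [← add_tsub_cancel_of_le (hle n), hadd]
      noncomm_ring
    have h2 := hT (t - m n * u n)
    rw [NNReal.coe_sub (hle n)] at h2
    have h3 : ‖T (m n * u n) - 1‖ ≤ C * t := (hT _).trans (by gcongr; exact hle n)
    rw [h1, norm_neg]
    calc _ ≤ ‖T (t - m n * u n) - 1‖ + ‖T (m n * u n) - 1‖ * ‖T (t - m n * u n) - 1‖ :=
          (norm_add_le _ _).trans (by gcongr; exact norm_mul_le _ _)
      _ = (1 + ‖T (m n * u n) - 1‖) * ‖T (t - m n * u n) - 1‖ := by ring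
      _ ≤ _ := by gcongr
  have hmain := ((hTlim.sub_const 1).sub (hlim.smul hA)).norm
  refine le_of_tendsto' hmain fun n => ?_
  have h1 := norm_nat_mul_sub_le hadd hT (m n) (u n)
  have h2 : ((m n * u n : ℝ≥0) : ℝ) • B n = (m n : ℝ) • (T (u n) - 1) := by
    simp only [B, smul_smul, hmu]
    congr 1
    field_simp
    rfl
  rw [h2]
  refine h1.trans ?_
  have := hle n
  rw [← NNReal.coe_le_coe] at this
  push_cast at this
  gcongr

lemma tendsto_inv_smul_sub_one {A : 𝔸}
    (hA : ∀ t : ℝ≥0, ‖T t - 1 - (t : ℝ) • A‖ ≤ C ^ 2 * t ^ 2) :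
    Tendsto (fun t : ℝ≥0 => (t : ℝ)⁻¹ • (T t - 1)) (𝓝[>] 0) (𝓝 A) := by
  rw [tendsto_iff_norm_sub_tendsto_zero]
  have hz : Tendsto (fun t : ℝ≥0 => C ^ 2 * (t : ℝ)) (𝓝[>] 0) (𝓝 0) := by
    have : Continuous fun t : ℝ≥0 => C ^ 2 * (t : ℝ) := by fun_prop
    simpa using (this.tendsto 0).mono_left nhdsWithin_le_nhds
  refine squeeze_zero' (Eventually.of_forall fun _ => norm_nonneg _) ?_ hz
  filter_upwards [self_mem_nhdsWithin] with t ht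
  have ht' : (0 : ℝ) < t := ht
  have h1 : (t : ℝ)⁻¹ • (T t - 1) - A = (t : ℝ)⁻¹ • (T t - 1 - (t : ℝ) • A) := by
    rw [smul_sub _ (T t - 1), inv_smul_smul₀ ht'.ne']
  rw [h1, norm_smul, norm_inv, Real.norm_of_nonneg ht'.le, inv_mul_le_iff₀ ht']
  exact (hA t).trans_eq (by ring)

end Semigroup

section Hilbert

variable {H : Type*} [NormedAddCommGroup H] [InnerProductSpace ℝ H] {A : H →L[ℝ] H}

/-- Removing the component of `h` along `e` does not change the form, since `A e = 0` and the range
of `A` is orthogonal to `e`. -/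
lemma mul_sub_sq_inner_le_of_orthogonal {e : H} (he : ‖e‖ = 1) (hAe : A e = 0)
    (hA : ∀ f, inner ℝ e (A f) = 0) {l : ℝ}
    (hl : ∀ f, inner ℝ e f = 0 → l * ‖f‖ ^ 2 ≤ -inner ℝ (A f) f) (h : H) :
    l * (‖h‖ ^ 2 - inner ℝ e h ^ 2) ≤ -inner ℝ (A h) h := by
  have hee : inner ℝ e e = 1 := by rw [real_inner_self_eq_norm_sq, he, one_pow]
  have h0 : inner ℝ e (h - inner ℝ e h • e) = 0 := by
    rw [inner_sub_right, inner_smul_right, hee, mul_one, sub_self]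
  have h1 := hl _ h0
  have h2 : ‖h - inner ℝ e h • e‖ ^ 2 = ‖h‖ ^ 2 - inner ℝ e h ^ 2 := by
    rw [← real_inner_self_eq_norm_sq, inner_sub_left, inner_smul_left, h0, inner_sub_right,
      inner_smul_right, real_inner_self_eq_norm_sq, real_inner_comm e h]
    simp
    ring
  have h3 : inner ℝ (A h) e = 0 := by rw [real_inner_comm]; exact hA h
  rw [h2, map_sub, map_smul, hAe, smul_zero, sub_zero, inner_sub_right, inner_smul_right, h3,
    mul_zero, sub_zero] at h1
  exact h1

/-- In the expansion of `‖h + t A h + r‖²` with `‖r‖ ≤ D t² ‖h‖`, the only first-order term is `2 t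
⟨A h, h⟩`. -/
lemma norm_sq_apply_le {S : H →L[ℝ] H} {D t : ℝ} (ht0 : 0 ≤ t) (ht1 : t ≤ 1)
    (hS : ‖S - 1 - t • A‖ ≤ D * t ^ 2) (h : H) :
    ‖S h‖ ^ 2 ≤ ‖h‖ ^ 2 + 2 * t * inner ℝ (A h) h
      + ((‖A‖ + D) ^ 2 + 2 * D) * t ^ 2 * ‖h‖ ^ 2 := by
  rcases ht0.eq_or_lt with rfl | ht
  · have h1 : S - 1 = 0 := by simpa using hS
    have h2 : S h = h := by
      rw [sub_eq_zero.1 h1]; rfl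
    simp [h2]
  have hD : 0 ≤ D := by
    have := (norm_nonneg _).trans hS
    exact nonneg_of_mul_nonneg_left this (by positivity)
  set r := (S - 1 - t • A) h with hr
  have hr' : ‖r‖ ≤ D * t ^ 2 * ‖h‖ := (ContinuousLinearMap.le_opNorm _ _).trans (by gcongr)
  have hSh : S h = h + (t • A h + r) := by
    simp [hr]
  have hv : ‖t • A h + r‖ ≤ t * (‖A‖ + D) * ‖h‖ := by
    calc _ ≤ ‖t • A h‖ + ‖r‖ := norm_add_le _ _
      _ ≤ t * (‖A‖ * ‖h‖) + D * t ^ 2 * ‖h‖ := by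
        rw [norm_smul, Real.norm_of_nonneg ht0]
        gcongr
        exact A.le_opNorm h
      _ ≤ t * (‖A‖ * ‖h‖) + D * t * ‖h‖ := by
        gcongr
        nlinarith
      _ = _ := by ring
  have hv2 : ‖t • A h + r‖ ^ 2 ≤ (t * (‖A‖ + D) * ‖h‖) ^ 2 := by gcongr
  have hi : inner ℝ h r ≤ ‖h‖ * (D * t ^ 2 * ‖h‖) :=
    (real_inner_le_norm _ _).trans (by gcongr)
  rw [hSh, norm_add_sq_real, inner_add_right, inner_smul_right, real_inner_comm h (A h)]
  nlinarith

end Hilbert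

end HoeffdingCTMC

/-! ### From the spectral gap to dissipation of the semigroup. -/

namespace HoeffdingCTMC

lemma inner_eq_integral_mul {α : Type*} [MeasurableSpace α] {π : Measure α} (f g : Lp ℝ 2 π) : inner ℝ f g = ∫ i, f i * g i ∂π := by
  rw [L2.inner_def]
  simp [mul_comm]

/-- Operator-norm convergence puts all of `L²(π)` in the domain of `𝓐`, so the infimum defining the
gap can be tested on any vector. -/
lemma generatorGraph_of_tendsto {E : Type*} [Countable E] [MeasurableSpace E]
    {P : ℝ≥0 → E → E → ℝ} {π : Measure E} {T : ℝ≥0 → Lp ℝ 2 π →L[ℝ] Lp ℝ 2 π}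
    (hpos : ∀ i, 0 < π.real {i}) (hT : ∀ t f i, T t f i = act P t f i)
    {A : Lp ℝ 2 π →L[ℝ] Lp ℝ 2 π}
    (hA : Tendsto (fun t : ℝ≥0 => (t : ℝ)⁻¹ • (T t - 1)) (𝓝[>] 0) (𝓝 A)) (f : Lp ℝ 2 π) :
    GeneratorGraph P π f (A f) := by
  have hae := fun {p : E → Prop} => ae_iff_forall_of_real_singleton_pos (p := p) hpos
  refine ⟨Lp.memLp f, Lp.memLp _, ?_⟩
  have h1 : Tendsto (fun t : ℝ≥0 => ‖(t : ℝ)⁻¹ • (T t f - f) - A f‖ₑ) (𝓝[>] 0) (𝓝 0) := by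
    have := ((ContinuousLinearMap.apply ℝ (Lp ℝ 2 π) f).continuous.tendsto A).comp hA
    have h2 := (this.sub_const (A f)).enorm
    simpa using h2
  refine h1.congr fun t => ?_
  rw [Lp.enorm_def]
  refine eLpNorm_congr_ae (hae.2 fun i => ?_)
  rw [hae.1 (Lp.coeFn_sub _ _), Pi.sub_apply, hae.1 (Lp.coeFn_smul _ _), Pi.smul_apply,
    hae.1 (Lp.coeFn_sub _ _), Pi.sub_apply, hT, smul_eq_mul, inv_mul_eq_div]

lemma mul_norm_sq_le_of_le_spectralGap {E : Type*} [MeasurableSpace E]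
    {P : ℝ≥0 → E → E → ℝ} {π : Measure E} {l : ℝ} (hl : (l : EReal) ≤ spectralGap P π)
    {A : Lp ℝ 2 π →L[ℝ] Lp ℝ 2 π}
    (hA : ∀ f : Lp ℝ 2 π, GeneratorGraph P π f (A f)) {f : Lp ℝ 2 π}
    (hf : ∫ i, f i ∂π = 0) : l * ‖f‖ ^ 2 ≤ -inner ℝ (A f) f := by
  rcases eq_or_ne f 0 with rfl | hf0
  · simp
  have hn : 0 < ‖f‖ := norm_pos_iff.2 hf0
  set g := ‖f‖⁻¹ • f with hg
  have hgn : ‖g‖ = 1 := by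
    rw [hg, norm_smul, norm_inv, norm_norm, inv_mul_cancel₀ hn.ne']
  have hg0 : ∫ i, g i ∂π = 0 := by
    rw [integral_congr_ae (Lp.coeFn_smul _ _)]
    simp only [Pi.smul_apply, smul_eq_mul]
    rw [integral_const_mul, hf, mul_zero]
  have hg1 : eLpNorm g 2 π = 1 := by
    rw [← Lp.enorm_def, ← ofReal_norm, hgn, ENNReal.ofReal_one]
  have h1 : (l : EReal) ≤ ((-∫ i, A g i * g i ∂π : ℝ) : EReal) :=
    hl.trans (sInf_le ⟨g, A g, hA g, hg1, hg0, rfl⟩)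
  rw [EReal.coe_le_coe_iff, ← inner_eq_integral_mul, hg, map_smul, inner_smul_left,
    inner_smul_right] at h1
  simp only [conj_trivial] at h1
  calc l * ‖f‖ ^ 2 ≤ -(‖f‖⁻¹ * (‖f‖⁻¹ * inner ℝ (A f) f)) * ‖f‖ ^ 2 := by gcongr
    _ = _ := by field_simp

variable {E : Type*} [Countable E] [MeasurableSpace E] [DiscreteMeasurableSpace E]
  {P : ℝ≥0 → E → E → ℝ} {π : Measure E} [IsProbabilityMeasure π]

lemma memLp_act (hP : IsTransitionFunction P) (hπ : IsInvariant P π)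
    (hpos : ∀ i, 0 < π.real {i}) {f : E → ℝ} (hf : MemLp f 2 π) (t : ℝ≥0) :
    MemLp (act P t f) 2 π := by
  have h := (memLp_act_sub hP hπ hpos hf (t := t) (r := 1)
    fun i => by linarith [hP.nonneg t i i]).1.add hf
  refine (memLp_congr_ae (Eventually.of_forall fun i => ?_)).1 h
  simp

/-- Short-time dissipation of the transition semigroup in `L²(π)` for a chain with a spectral
gap. -/
lemma exists_integral_sq_act_le {Q : E → E → ℝ} (hQb : UniformlyBounded Q) (hP : IsQProcess Q P)
    (hπ : IsInvariant P π) (hpos : ∀ i, 0 < π.real {i}) {l : ℝ}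
    (hl : (l : EReal) ≤ spectralGap P π) :
    ∃ K : ℝ, 0 ≤ K ∧ ∀ δ : ℝ≥0, δ ≤ 1 → ∀ h : E → ℝ, MemLp h 2 π →
      ∫ i, act P δ h i ^ 2 ∂π ≤ ∫ i, h i ^ 2 ∂π
        - 2 * δ * l * (∫ i, h i ^ 2 ∂π - (∫ i, h i ∂π) ^ 2) + K * δ ^ 2 * ∫ i, h i ^ 2 ∂π := by
  have hT := hP.isTransitionFunction
  have hae := fun {p : E → Prop} => ae_iff_forall_of_real_singleton_pos (p := p) hpos
  obtain ⟨c, hc⟩ := hQb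
  have hc' : ∀ (t : ℝ≥0) i, 1 - P t i i ≤ c * (t : ℝ) := fun t i =>
    (hP.one_sub_diag_le t i).trans
      (mul_le_mul_of_nonneg_right (hc (Set.mem_range_self i)) t.coe_nonneg)
  obtain ⟨T, hTact, hT1⟩ := exists_clm_act hT hπ hpos hc'
  have hint : ∀ f : Lp ℝ 2 π, Integrable f π := fun f => (Lp.memLp f).integrable (by norm_num)
  have hadd : ∀ s t, T (s + t) = T s * T t := fun s t => by
    ext1 f
    ext1
    refine hae.2 fun i => ?_
    have : (T t f : E → ℝ) = act P t f := funext (hTact t f)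
    change T (s + t) f i = T s (T t f) i
    rw [hTact, hTact, this, act_act hT hπ hpos (hint f)]
  obtain ⟨A, hA⟩ := exists_generator_of_norm_sub_one_le hadd hT1
  have hlim := tendsto_inv_smul_sub_one hA
  have hgraph := generatorGraph_of_tendsto hpos hTact hlim
  -- The constant function 1. Row sums make it a fixed vector, and invariance preserves the pairing
  -- with it; hence `A e = 0` and the range of `A` is orthogonal to `e`.
  set e : Lp ℝ 2 π := (memLp_const (1 : ℝ)).toLp with he
  have he1 : ∀ i, e i = 1 := hae.1 (memLp_const (1 : ℝ)).coeFn_toLp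
  have hen : ‖e‖ = 1 := by
    have : ‖e‖ ^ 2 = 1 := by rw [norm_sq_eq_integral_sq]; simp [he1]
    exact (sq_eq_sq₀ (norm_nonneg e) zero_le_one).1 (by rw [this, one_pow])
  have hinner : ∀ f : Lp ℝ 2 π, inner ℝ e f = ∫ i, f i ∂π := fun f => by
    rw [inner_eq_integral_mul]; simp [he1]
  have hAe : A e = 0 := by
    have h1 := ((ContinuousLinearMap.apply ℝ (Lp ℝ 2 π) e).continuous.tendsto A).comp hlim
    refine tendsto_nhds_unique h1 (tendsto_const_nhds.congr fun t => ?_)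
    have : T t e = e := by
      ext1
      refine hae.2 fun i => ?_
      rw [hTact, act]
      simp only [he1, mul_one]
      exact (hT.row_sum t i).tsum_eq
    simp [this]
  have hAe' : ∀ f, inner ℝ e (A f) = 0 := fun f => by
    have h1 := ((ContinuousLinearMap.apply ℝ (Lp ℝ 2 π) f).continuous.tendsto A).comp hlim
    have h2 := (tendsto_const_nhds (x := e)).inner (𝕜 := ℝ) h1
    refine tendsto_nhds_unique h2 (tendsto_const_nhds.congr fun t => ?_)
    have : inner ℝ e (T t f) = inner ℝ e f := by
      rw [hinner, hinner, ← integral_act hT hπ (hint f) t]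
      exact integral_congr_ae (hae.2 (hTact t f))
    simp [inner_smul_right, inner_sub_right, this]
  have hgap := mul_sub_sq_inner_le_of_orthogonal hen hAe hAe' (l := l) fun f hf =>
    mul_norm_sq_le_of_le_spectralGap hl hgraph ((hinner f).symm.trans hf)
  refine ⟨(‖A‖ + (2 * c) ^ 2) ^ 2 + 2 * (2 * c) ^ 2, by positivity, fun δ hδ h hh => ?_⟩
  have h1 := norm_sq_apply_le δ.coe_nonneg (by exact_mod_cast hδ) (hA δ) hh.toLp
  have h2 := hgap hh.toLp
  have h3 : (hh.toLp : E → ℝ) = h := funext (hae.1 hh.coeFn_toLp)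
  rw [hinner, h3] at h2
  rw [norm_sq_eq_integral_sq, norm_sq_eq_integral_sq] at h1
  rw [norm_sq_eq_integral_sq] at h2
  simp only [hTact, h3] at h1 h2
  nlinarith [mul_le_mul_of_nonneg_left h2 δ.coe_nonneg]

end HoeffdingCTMC

/-! ### The rank-one eigenvalue problem. -/

namespace HoeffdingCTMC

lemma integrable_mul_sq {α : Type*} [MeasurableSpace α] {π : Measure α} {V h : α → ℝ} {a b : ℝ}
    (hVm : Measurable V) (hV : ∀ i, V i ∈ Set.Icc a b) (hh : MemLp h 2 π) :
    Integrable (fun i => V i * h i ^ 2) π :=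
  hh.integrable_sq.bdd_mul (c := max |a| |b|) hVm.aestronglyMeasurable
    (Eventually.of_forall fun i => abs_le_max_abs_abs (hV i).1 (hV i).2)

section QuadraticForm

variable {α : Type*} [MeasurableSpace α] {π : Measure α} [IsProbabilityMeasure π]
  {V h : α → ℝ} {a b : ℝ}

/-- By convexity `1/(θ - x)` lies below its chord on `[a, b]`. As `V` is centred, the chord
integrates to `(θ - a - b)/((θ - a)(θ - b))`, which is at most 1 because denominator minus numerator
equals `(θ - 1 - (a+b)/2)² + θ - 1 - (b-a)²/4`. -/
lemma integral_inv_sub_le_one (hVm : Measurable V) (hV : ∀ i, V i ∈ Set.Icc a b)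
    (hV0 : ∫ i, V i ∂π = 0) {θ : ℝ} (hθ : 1 + (b - a) ^ 2 / 4 < θ) (hb : b < θ) :
    Integrable (fun i => (θ - V i)⁻¹) π ∧ ∫ i, (θ - V i)⁻¹ ∂π ≤ 1 := by
  have hab : a ≤ b := by
    obtain ⟨i⟩ : Nonempty α := nonempty_of_isProbabilityMeasure π
    exact (hV i).1.trans (hV i).2
  have hVi : Integrable V π := Integrable.of_mem_Icc a b hVm.aemeasurable (Eventually.of_forall hV)
  have hD : 0 < (θ - a) * (θ - b) := mul_pos (by linarith) (by linarith)
  have hle : ∀ i, (θ - V i)⁻¹ ≤ ((θ - a) * (θ - b))⁻¹ * (θ - a - b + V i) := fun i => by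
    obtain ⟨h1, h2⟩ := hV i
    have h3 : 0 < θ - V i := by linarith
    rw [inv_mul_eq_div, inv_eq_one_div, div_le_div_iff₀ h3 hD]
    nlinarith [mul_nonneg (sub_nonneg.2 h1) (sub_nonneg.2 h2)]
  have hi : Integrable (fun i => ((θ - a) * (θ - b))⁻¹ * (θ - a - b + V i)) π :=
    ((integrable_const _).add hVi).const_mul _
  have hint : Integrable (fun i => (θ - V i)⁻¹) π := by
    refine hi.mono' (by fun_prop) (Eventually.of_forall fun i => ?_)
    rw [Real.norm_of_nonneg (inv_nonneg.2 (by linarith [(hV i).2]))]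
    exact hle i
  refine ⟨hint, (integral_mono hint hi hle).trans ?_⟩
  rw [integral_const_mul, integral_add (integrable_const _) hVi, hV0, inv_mul_le_iff₀ hD]
  simp only [integral_const, probReal_univ, smul_eq_mul]
  nlinarith [sq_nonneg (θ - 1 - (a + b) / 2)]

/-- Cauchy–Schwarz: `(∫ h)² ≤ ∫ (θ - V) h² · ∫ (θ - V)⁻¹`, with last factor at most 1. Strictness of
`hθ` keeps `θ - V` positive. -/
lemma sq_integral_le_of_lt (hVm : Measurable V) (hV : ∀ i, V i ∈ Set.Icc a b)
    (hV0 : ∫ i, V i ∂π = 0) (hh : MemLp h 2 π) {θ : ℝ} (hθ : 1 + (b - a) ^ 2 / 4 < θ) :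
    (∫ i, h i ∂π) ^ 2 ≤ θ * ∫ i, h i ^ 2 ∂π - ∫ i, V i * h i ^ 2 ∂π := by
  have hVi : Integrable V π := Integrable.of_mem_Icc a b hVm.aemeasurable (Eventually.of_forall hV)
  have ha : a ≤ 0 := by
    have := integral_mono (integrable_const a) hVi fun i => (hV i).1
    simpa [hV0] using this
  have hb : b < θ := by nlinarith [sq_nonneg (b - a - 2)]
  obtain ⟨h1, h2⟩ := integral_inv_sub_le_one hVm hV hV0 hθ hb
  set x := ∫ i, h i ∂π with hx
  have hhi : Integrable h π := hh.integrable (by norm_num)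
  have hVh := integrable_mul_sq hVm hV hh
  have hq : Integrable (fun i => θ * h i ^ 2 - V i * h i ^ 2) π :=
    (hh.integrable_sq.const_mul θ).sub hVh
  have hq' : Integrable (fun i => x ^ 2 * (θ - V i)⁻¹) π := h1.const_mul _
  have hle : ∀ i, 2 * x * h i ≤ (θ * h i ^ 2 - V i * h i ^ 2) + x ^ 2 * (θ - V i)⁻¹ := fun i => by
    have h3 : 0 < θ - V i := by linarith [(hV i).2]
    have h4 : (θ * h i ^ 2 - V i * h i ^ 2) + x ^ 2 * (θ - V i)⁻¹ - 2 * x * h i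
        = (θ - V i)⁻¹ * ((θ - V i) * h i - x) ^ 2 := by
      field_simp
      ring
    have h5 : 0 ≤ (θ - V i)⁻¹ * ((θ - V i) * h i - x) ^ 2 := by positivity
    linarith
  have h6 := integral_mono (hhi.const_mul (2 * x)) (hq.add hq') hle
  simp only [Pi.add_apply] at h6
  rw [integral_add hq hq', integral_const_mul, integral_const_mul,
    integral_sub (hh.integrable_sq.const_mul θ) hVh, integral_const_mul, ← hx] at h6
  nlinarith [sq_nonneg x]

lemma sq_integral_le (hVm : Measurable V) (hV : ∀ i, V i ∈ Set.Icc a b)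
    (hV0 : ∫ i, V i ∂π = 0) (hh : MemLp h 2 π) :
    (∫ i, h i ∂π) ^ 2 ≤ (1 + (b - a) ^ 2 / 4) * ∫ i, h i ^ 2 ∂π - ∫ i, V i * h i ^ 2 ∂π := by
  have hc : Continuous fun θ : ℝ => θ * ∫ i, h i ^ 2 ∂π - ∫ i, V i * h i ^ 2 ∂π := by fun_prop
  refine ge_of_tendsto ((hc.tendsto (1 + (b - a) ^ 2 / 4)).mono_left
    (nhdsWithin_le_nhds (s := Set.Ioi (1 + (b - a) ^ 2 / 4)))) ?_
  filter_upwards [self_mem_nhdsWithin] with θ hθ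
  exact sq_integral_le_of_lt hVm hV hV0 hh hθ

/-- The largest eigenvalue of a centred multiplication operator perturbed by the dissipation
`l • (π - 1)` is at most `(b - a)² / (4 l)`. -/
lemma mul_sq_integral_le (hVm : Measurable V) (hV : ∀ i, V i ∈ Set.Icc a b)
    (hV0 : ∫ i, V i ∂π = 0) (hh : MemLp h 2 π) {l : ℝ} (hl : 0 < l) :
    l * (∫ i, h i ∂π) ^ 2 ≤
      (l + (b - a) ^ 2 / (4 * l)) * ∫ i, h i ^ 2 ∂π - ∫ i, V i * h i ^ 2 ∂π := by
  have h1 := sq_integral_le (V := fun i => l⁻¹ * V i) (a := l⁻¹ * a) (b := l⁻¹ * b) (π := π)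
    (by fun_prop)
    (fun i => ⟨by have := (hV i).1; gcongr, by have := (hV i).2; gcongr⟩)
    (by rw [integral_const_mul, hV0, mul_zero]) hh
  simp only [mul_assoc] at h1
  rw [integral_const_mul] at h1
  have h2 := mul_le_mul_of_nonneg_left h1 hl.le
  refine h2.trans_eq ?_
  field_simp

end QuadraticForm

/-- The eigenvalue bound turns the dissipation into a factor `1 + 2δ(L - V)`, with `L = (b - a)² /
(4 l)`. It is at most `exp(2δ(L - V))`, which cancels the weight `exp(2δV)` exactly. -/
lemma integral_sq_exp_mul_le {α : Type*} [MeasurableSpace α] {π : Measure α}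
    [IsProbabilityMeasure π] {V f : α → ℝ} {a b : ℝ} (hVm : Measurable V)
    (hV : ∀ i, V i ∈ Set.Icc a b) (hV0 : ∫ i, V i ∂π = 0) (hf : MemLp f 2 π) {l δ K : ℝ}
    (hl : 0 < l) (hδ : 0 ≤ δ) (hK : 0 ≤ K)
    (hh : MemLp (fun i => Real.exp (δ * V i) * f i) 2 π) :
    (∫ i, (Real.exp (δ * V i) * f i) ^ 2 ∂π) - 2 * δ * l * ((∫ i, (Real.exp (δ * V i) * f i) ^ 2 ∂π)
        - (∫ i, Real.exp (δ * V i) * f i ∂π) ^ 2)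
      + K * δ ^ 2 * ∫ i, (Real.exp (δ * V i) * f i) ^ 2 ∂π ≤
    (Real.exp (2 * δ * ((b - a) ^ 2 / (4 * l))) + K * δ ^ 2 * Real.exp (2 * δ * b))
      * ∫ i, f i ^ 2 ∂π := by
  set h : α → ℝ := fun i => Real.exp (δ * V i) * f i with hdef
  set L := (b - a) ^ 2 / (4 * l) with hL
  have h1 := mul_sq_integral_le hVm hV hV0 hh hl
  have hVh := integrable_mul_sq hVm hV hh
  have hh2 : Integrable (fun i => h i ^ 2) π := hh.integrable_sq
  have hsq : ∀ i, h i ^ 2 = Real.exp (2 * δ * V i) * f i ^ 2 := fun i => by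
    rw [hdef, mul_pow, ← Real.exp_nat_mul]; push_cast; ring_nf
  have h2 : (1 + 2 * δ * L) * ∫ i, h i ^ 2 ∂π - 2 * δ * ∫ i, V i * h i ^ 2 ∂π ≤
      Real.exp (2 * δ * L) * ∫ i, f i ^ 2 ∂π := by
    rw [← integral_const_mul, ← integral_const_mul, ← integral_const_mul,
      ← integral_sub (hh2.const_mul _) (hVh.const_mul _)]
    refine integral_mono ((hh2.const_mul _).sub (hVh.const_mul _)) (hf.integrable_sq.const_mul _)
      fun i => ?_
    have h3 := Real.add_one_le_exp (2 * δ * (L - V i))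
    have h4 : (1 + 2 * δ * L) * h i ^ 2 - 2 * δ * (V i * h i ^ 2) =
        (2 * δ * (L - V i) + 1) * h i ^ 2 := by ring
    change (1 + 2 * δ * L) * h i ^ 2 - 2 * δ * (V i * h i ^ 2) ≤ _
    rw [h4, hsq]
    calc _ ≤ Real.exp (2 * δ * (L - V i)) * (Real.exp (2 * δ * V i) * f i ^ 2) := by gcongr
      _ = Real.exp (2 * δ * L) * f i ^ 2 := by
        rw [← mul_assoc, ← Real.exp_add]; ring_nf
  have h3 : ∫ i, h i ^ 2 ∂π ≤ Real.exp (2 * δ * b) * ∫ i, f i ^ 2 ∂π := by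
    rw [← integral_const_mul]
    refine integral_mono hh2 (hf.integrable_sq.const_mul _) fun i => ?_
    have := (hV i).2
    simp only [hsq]
    gcongr
  have h4 := mul_le_mul_of_nonneg_left h1 (mul_nonneg zero_le_two hδ)
  have h5 := mul_le_mul_of_nonneg_left h3 (mul_nonneg hK (sq_nonneg δ))
  nlinarith

end HoeffdingCTMC

/-! ### The discretized Feynman–Kac recursion. -/

namespace HoeffdingCTMC

/-- One step of the discretized Feynman–Kac recursion with potential `V` and time step `δ`. -/
noncomputable def feynmanKacStep {E : Type*} (P : ℝ≥0 → E → E → ℝ) (V : E → ℝ) (δ : ℝ≥0)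
    (ψ : E → ℝ) : E → ℝ :=
  act P δ fun i => Real.exp (δ * V i) * ψ i

variable {E : Type*} [Countable E] [MeasurableSpace E] [DiscreteMeasurableSpace E]
  {P : ℝ≥0 → E → E → ℝ} {π : Measure E} [IsProbabilityMeasure π] {V : E → ℝ} {a b : ℝ}

omit [Countable E] [IsProbabilityMeasure π] in
lemma memLp_exp_mul (hV : ∀ i, V i ∈ Set.Icc a b) {ψ : E → ℝ} (hψ : MemLp ψ 2 π) (δ : ℝ≥0) :
    MemLp (fun i => Real.exp (δ * V i) * ψ i) 2 π := by
  refine hψ.of_le_mul (c := Real.exp (δ * b)) ?_ (Eventually.of_forall fun i => ?_)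
  · exact (Measurable.of_discrete.aestronglyMeasurable).mul hψ.1
  · rw [norm_mul, Real.norm_of_nonneg (Real.exp_pos _).le]
    have := (hV i).2
    gcongr

lemma memLp_feynmanKacStep (hP : IsTransitionFunction P) (hπ : IsInvariant P π)
    (hpos : ∀ i, 0 < π.real {i}) (hV : ∀ i, V i ∈ Set.Icc a b) {ψ : E → ℝ} (hψ : MemLp ψ 2 π)
    (δ : ℝ≥0) : MemLp (feynmanKacStep P V δ ψ) 2 π :=
  memLp_act hP hπ hpos (memLp_exp_mul hV hψ δ) δ

lemma memLp_iterate_feynmanKacStep (hP : IsTransitionFunction P) (hπ : IsInvariant P π)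
    (hpos : ∀ i, 0 < π.real {i}) (hV : ∀ i, V i ∈ Set.Icc a b) {ψ : E → ℝ} (hψ : MemLp ψ 2 π)
    (δ : ℝ≥0) (n : ℕ) : MemLp ((feynmanKacStep P V δ)^[n] ψ) 2 π := by
  induction n generalizing ψ with
  | zero => exact hψ
  | succ n ih => exact ih (memLp_feynmanKacStep hP hπ hpos hV hψ δ)

lemma exists_integral_iterate_feynmanKacStep_le {Q : E → E → ℝ} (hQb : UniformlyBounded Q)
    (hP : IsQProcess Q P) (hπ : IsInvariant P π) (hpos : ∀ i, 0 < π.real {i}) {l : ℝ} (hl0 : 0 < l)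
    (hl : (l : EReal) ≤ spectralGap P π) (hV : ∀ i, V i ∈ Set.Icc a b) (hV0 : ∫ i, V i ∂π = 0) :
    ∃ K : ℝ, ∀ δ : ℝ≥0, δ ≤ 1 → ∀ n : ℕ,
      ∫ i, ((feynmanKacStep P V δ)^[n] fun _ => 1) i ∂π ≤
        Real.exp (n * (δ * ((b - a) ^ 2 / (4 * l)) + K * δ ^ 2)) := by
  have hT := hP.isTransitionFunction
  obtain ⟨K, hK, hstep⟩ := exists_integral_sq_act_le hQb hP hπ hpos hl
  set L := (b - a) ^ 2 / (4 * l) with hL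
  have hL0 : 0 ≤ L := by positivity
  refine ⟨K * Real.exp (2 * |b|) / 2, fun δ hδ n => ?_⟩
  have hδ1 : (δ : ℝ) ≤ 1 := by exact_mod_cast hδ
  -- Growth factor of the squared norm per step; the 2 disappears when `(∫ u)² ≤ ∫ u²` is used at
  -- the end.
  set r := Real.exp (2 * (δ * L + K * Real.exp (2 * |b|) / 2 * δ ^ 2)) with hr
  have hr' : Real.exp (2 * δ * L) + K * δ ^ 2 * Real.exp (2 * δ * b) ≤ r := by
    have h1 : (1 : ℝ) ≤ Real.exp (2 * δ * L) := Real.one_le_exp (by positivity)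
    have h2 : Real.exp (2 * δ * b) ≤ Real.exp (2 * |b|) := by
      refine Real.exp_le_exp.2 ?_
      nlinarith [le_abs_self b, abs_nonneg b, δ.coe_nonneg]
    have h3 := Real.add_one_le_exp (K * δ ^ 2 * Real.exp (2 * |b|))
    have h4 : r = Real.exp (2 * δ * L) * Real.exp (K * δ ^ 2 * Real.exp (2 * |b|)) := by
      rw [hr, ← Real.exp_add]; ring_nf
    have h5 : K * δ ^ 2 * Real.exp (2 * δ * b) ≤ K * δ ^ 2 * Real.exp (2 * |b|) := by gcongr
    have h6 : 0 ≤ K * δ ^ 2 * Real.exp (2 * |b|) := by positivity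
    rw [h4]
    nlinarith
  have hone : ∀ ψ : E → ℝ, MemLp ψ 2 π →
      ∫ i, feynmanKacStep P V δ ψ i ^ 2 ∂π ≤ r * ∫ i, ψ i ^ 2 ∂π := fun ψ hψ => by
    have hh := memLp_exp_mul hV hψ δ
    refine (hstep δ hδ _ hh).trans ((integral_sq_exp_mul_le Measurable.of_discrete hV hV0 hψ hl0
      δ.coe_nonneg hK hh).trans ?_)
    exact mul_le_mul_of_nonneg_right hr' (integral_nonneg fun _ => sq_nonneg _)
  have hiter : ∀ (n : ℕ) (ψ : E → ℝ), MemLp ψ 2 π →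
      ∫ i, ((feynmanKacStep P V δ)^[n] ψ) i ^ 2 ∂π ≤ r ^ n * ∫ i, ψ i ^ 2 ∂π := fun n => by
    induction n with
    | zero => intro ψ _; simp
    | succ n ih =>
      intro ψ hψ
      refine (ih _ (memLp_feynmanKacStep hT hπ hpos hV hψ δ)).trans ?_
      rw [pow_succ, mul_assoc]
      gcongr
      exact hone ψ hψ
  have h1 := hiter n (fun _ => 1) (memLp_const 1)
  have hu := memLp_iterate_feynmanKacStep hT hπ hpos hV (memLp_const (1 : ℝ)) δ n
  set u := (feynmanKacStep P V δ)^[n] fun _ => (1 : ℝ)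
  have h2 : (∫ i, u i ∂π) ^ 2 ≤ ∫ i, u i ^ 2 ∂π := by
    have h3 := ProbabilityTheory.variance_nonneg u π
    rw [ProbabilityTheory.variance_eq_sub hu] at h3
    simpa using h3
  refine le_of_sq_le_sq (h2.trans (h1.trans_eq ?_)) (Real.exp_pos _).le
  rw [hr, ← Real.exp_nat_mul, ← Real.exp_nat_mul]
  simp only [one_pow, integral_const, probReal_univ, smul_eq_mul, mul_one]
  push_cast
  ring_nf

section Markov

variable {Ω : Type*} [MeasurableSpace Ω] {μ : Measure Ω} [IsProbabilityMeasure μ]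
  {X : ℝ≥0 → Ω → E}

omit [Countable E] [IsProbabilityMeasure π] [DiscreteMeasurableSpace E] [IsProbabilityMeasure μ] in
lemma IsMarkovChain.real_step (hX : IsMarkovChain P π μ X) (δ : ℝ≥0) (m : ℕ) (y : Fin (m + 1) → E)
    (j : E) :
    μ.real {ω | (∀ k : Fin (m + 1), X (k * δ) ω = y k) ∧ X ((m + 1 : ℕ) * δ) ω = j} =
      μ.real {ω | ∀ k : Fin (m + 1), X (k * δ) ω = y k} * P δ (y (Fin.last m)) j := by
  -- Only indices up to `m + 1` enter; beyond them `j` is filler.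
  let i : ℕ → E := fun k => if h : k < m + 1 then y ⟨k, h⟩ else j
  let τ : ℕ → ℝ≥0 := fun k => k * δ
  have hτ0 : τ 0 = 0 := by simp [τ]
  have hτ : Monotone τ := fun k l hkl => by simp only [τ]; gcongr
  have hi : ∀ k (h : k < m + 1), i k = y ⟨k, h⟩ := fun k h => dif_pos h
  have hij : i (m + 1) = j := dif_neg (lt_irrefl _)
  have h1 := hX.finite_dim m τ i hτ0 hτ
  have h2 := hX.finite_dim (m + 1) τ i hτ0 hτ
  have hs : ∀ ω, (∀ k ≤ m, X (τ k) ω = i k) ↔ ∀ k : Fin (m + 1), X (k * δ) ω = y k := fun ω =>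
    ⟨fun h k => (h k (Nat.le_of_lt_succ k.2)).trans (hi k k.2),
      fun h k hk => (h ⟨k, Nat.lt_succ_of_le hk⟩).trans (hi k (Nat.lt_succ_of_le hk)).symm⟩
  have hs' : ∀ ω, (∀ k ≤ m + 1, X (τ k) ω = i k) ↔
      (∀ k : Fin (m + 1), X (k * δ) ω = y k) ∧ X ((m + 1 : ℕ) * δ) ω = j := fun ω => by
    rw [← hs]
    constructor
    · exact fun h => ⟨fun k hk => h k (hk.trans (Nat.le_succ m)), (h (m + 1) le_rfl).trans hij⟩
    · rintro ⟨h, h'⟩ k hk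
      rcases Nat.le_succ_iff.1 hk with hk | rfl
      · exact h k hk
      · exact h'.trans hij.symm
  simp only [hs] at h1
  simp only [hs', Finset.prod_range_succ] at h2
  have hτδ : τ (m + 1) - τ m = δ := by simp [τ, add_mul]
  rw [h2, h1, hij, hi m (Nat.lt_succ_self m), hτδ, mul_assoc]
  rfl

omit [IsProbabilityMeasure π] in
/-- The Markov property on a time grid. -/
lemma IsMarkovChain.lintegral_mul_step (hX : IsMarkovChain P π μ X)
    (δ : ℝ≥0) (m : ℕ) (F : (Fin (m + 1) → E) → ℝ≥0∞) (G : E → ℝ≥0∞) :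
    ∫⁻ ω, F (fun k => X (k * δ) ω) * G (X ((m + 1 : ℕ) * δ) ω) ∂μ =
      ∫⁻ ω, F (fun k => X (k * δ) ω) * ∑' j, ENNReal.ofReal (P δ (X (m * δ) ω) j) * G j ∂μ := by
  let Y : Ω → Fin (m + 1) → E := fun ω k => X (k * δ) ω
  have hY : Measurable Y := measurable_pi_lambda _ fun k => hX.measurable _
  have hZ : Measurable fun ω => (Y ω, X ((m + 1 : ℕ) * δ) ω) := hY.prodMk (hX.measurable _)
  have hpt : ∀ y j, μ.map (fun ω => (Y ω, X ((m + 1 : ℕ) * δ) ω)) {(y, j)} =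
      μ.map Y {y} * ENNReal.ofReal (P δ (y (Fin.last m)) j) := fun y j => by
    rw [Measure.map_apply hZ (measurableSet_singleton _),
      Measure.map_apply hY (measurableSet_singleton _)]
    have h := hX.real_step δ m y j
    have e1 : (fun ω => (Y ω, X ((m + 1 : ℕ) * δ) ω)) ⁻¹' {(y, j)} =
        {ω | (∀ k : Fin (m + 1), X (k * δ) ω = y k) ∧ X ((m + 1 : ℕ) * δ) ω = j} := by
      ext ω; simp [Y, funext_iff]
    have e2 : Y ⁻¹' {y} = {ω | ∀ k : Fin (m + 1), X (k * δ) ω = y k} := by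
      ext ω; simp [Y, funext_iff]
    rw [e1, e2, ← ofReal_measureReal, h, ENNReal.ofReal_mul measureReal_nonneg, ofReal_measureReal]
  have hl : ∫⁻ ω, F (Y ω) * G (X ((m + 1 : ℕ) * δ) ω) ∂μ =
      ∫⁻ z, F z.1 * G z.2 ∂μ.map (fun ω => (Y ω, X ((m + 1 : ℕ) * δ) ω)) :=
    (lintegral_map (f := fun z : (Fin (m + 1) → E) × E => F z.1 * G z.2)
      (measurable_of_countable _) hZ).symm
  have hr : ∫⁻ ω, F (Y ω) * ∑' j, ENNReal.ofReal (P δ (Y ω (Fin.last m)) j) * G j ∂μ =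
      ∫⁻ y, F y * ∑' j, ENNReal.ofReal (P δ (y (Fin.last m)) j) * G j ∂μ.map Y :=
    (lintegral_map (f := fun y => F y * ∑' j, ENNReal.ofReal (P δ (y (Fin.last m)) j) * G j)
      (measurable_of_countable _) hY).symm
  refine hl.trans (Eq.trans ?_ hr.symm)
  -- Both laws live on countable spaces, so comparing atoms suffices.
  rw [lintegral_countable', lintegral_countable', ENNReal.tsum_prod']
  refine tsum_congr fun y => ?_
  rw [mul_assoc, ← ENNReal.tsum_mul_right, ← ENNReal.tsum_mul_left]
  refine tsum_congr fun j => ?_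
  rw [hpt]
  ring

lemma tsum_ofReal_mul_eq_ofReal_act (hP : IsTransitionFunction P) (hπ : IsInvariant P π)
    (hpos : ∀ i, 0 < π.real {i}) {f : E → ℝ} (hf : Integrable f π) (hf0 : ∀ i, 0 ≤ f i) (t : ℝ≥0)
    (i : E) : ∑' j, ENNReal.ofReal (P t i j) * ENNReal.ofReal (f j) = ENNReal.ofReal (act P t f i) := by
  rw [act, ENNReal.ofReal_tsum_of_nonneg (fun j => mul_nonneg (hP.nonneg t i j) (hf0 j))
    (summable_mul_of_integrable hP hπ hpos hf t i)]
  exact tsum_congr fun j => (ENNReal.ofReal_mul (hP.nonneg t i j)).symm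

omit [Countable E] [MeasurableSpace E] [DiscreteMeasurableSpace E] in
lemma feynmanKacStep_nonneg (hP : IsTransitionFunction P) {ψ : E → ℝ} (hψ : ∀ i, 0 ≤ ψ i)
    (δ : ℝ≥0) (i : E) : 0 ≤ feynmanKacStep P V δ ψ i :=
  tsum_nonneg fun j => mul_nonneg (hP.nonneg δ i j) (mul_nonneg (Real.exp_pos _).le (hψ j))

/-- The discretized Feynman–Kac formula. -/
lemma IsMarkovChain.lintegral_prod_exp (hP : IsTransitionFunction P) (hπ : IsInvariant P π)
    (hpos : ∀ i, 0 < π.real {i}) (hX : IsMarkovChain P π μ X) (hV : ∀ i, V i ∈ Set.Icc a b)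
    (δ : ℝ≥0) (n : ℕ) {ψ : E → ℝ} (hψ : MemLp ψ 2 π) (hψ0 : ∀ i, 0 ≤ ψ i) :
    ∫⁻ ω, (∏ k ∈ Finset.range n, ENNReal.ofReal (Real.exp (δ * V (X ((k + 1 : ℕ) * δ) ω)))) *
        ENNReal.ofReal (ψ (X (n * δ) ω)) ∂μ =
      ∫⁻ i, ENNReal.ofReal (((feynmanKacStep P V δ)^[n] ψ) i) ∂π := by
  induction n generalizing ψ with
  | zero =>
    have hmap : μ.map (X 0) = π := by
      refine Measure.ext_of_singleton fun i => ?_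
      rw [Measure.map_apply (hX.measurable 0) (measurableSet_singleton _)]
      have h := hX.finite_dim 0 (fun _ => 0) (fun _ => i) rfl monotone_const
      simp only [nonpos_iff_eq_zero, forall_eq, Finset.range_zero, Finset.prod_empty, mul_one] at h
      exact (measureReal_eq_measureReal_iff).1 h
    simp only [Finset.range_zero, Finset.prod_empty, one_mul, Nat.cast_zero, zero_mul,
      Function.iterate_zero, id]
    conv_rhs => rw [← hmap]
    rw [lintegral_map (measurable_of_countable _) (hX.measurable 0)]
  | succ n ih =>
    -- The last time is integrated out first, which replaces `ψ` by one step applied to `ψ`.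
    rw [Function.iterate_succ_apply, ← ih (memLp_feynmanKacStep hP hπ hpos hV hψ δ)
      (feynmanKacStep_nonneg hP hψ0 δ)]
    have hh := (memLp_exp_mul hV hψ δ).integrable (by norm_num)
    have h := hX.lintegral_mul_step δ n
      -- The shift `k.succ` leaves time 0 unweighted: the potential is read at right endpoints.
      (fun y => ∏ k : Fin n, ENNReal.ofReal (Real.exp (δ * V (y k.succ))))
      (fun i => ENNReal.ofReal (Real.exp (δ * V i) * ψ i))
    simp only [tsum_ofReal_mul_eq_ofReal_act hP hπ hpos hh
      (fun i => mul_nonneg (Real.exp_pos _).le (hψ0 i))] at h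
    simp only [Fin.val_succ] at h
    simp only [Finset.prod_range]
    refine Eq.trans (lintegral_congr fun ω => ?_) h
    rw [Fin.prod_univ_castSucc, mul_assoc, ← ENNReal.ofReal_mul (Real.exp_pos _).le]
    simp

end Markov

end HoeffdingCTMC

/-! ### Passage to continuous time and the Chernoff bound. -/

namespace HoeffdingCTMC

/-- Riemann sums at right endpoints along a path that is right-continuous for the discrete
topology. -/
lemma tendsto_riemann_sum_of_right_continuous {E : Type*} {x : ℝ≥0 → E}
    (hx : ∀ t, ∀ᶠ s in 𝓝[≥] t, x s = x t) {g : E → ℝ} {M : ℝ} (hg : ∀ i, |g i| ≤ M) (t : ℝ≥0)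
    (ht : 0 < t) :
    Tendsto (fun n : ℕ => ∑ k ∈ Finset.range n, ((t / n : ℝ≥0) : ℝ) * g (x ((k + 1 : ℕ) * (t / n))))
      atTop (𝓝 (∫ s in (0 : ℝ)..t, g (x s.toNNReal))) := by
  have ht' : (0 : ℝ) < t := ht
  -- The ceiling picks the right endpoint of the mesh cell of `s`, so the sampling times approach
  -- `s` from the right and path values are eventually equal.
  let F : ℕ → ℝ → ℝ := fun n s => g (x ((⌈s * n / t⌉₊ : ℕ) * (t / n)))
  have hFm : ∀ n, Measurable (F n) := fun n => by
    have h1 : Measurable fun s : ℝ => ⌈s * n / t⌉₊ := Nat.measurable_ceil.comp (by fun_prop)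
    exact (measurable_from_nat (f := fun k : ℕ => g (x (k * (t / n))))).comp h1
  have hlim : Tendsto (fun n => ∫ s in (0 : ℝ)..t, F n s) atTop
      (𝓝 (∫ s in (0 : ℝ)..t, g (x s.toNNReal))) := by
    refine intervalIntegral.tendsto_integral_filter_of_dominated_convergence (fun _ => M)
      (Eventually.of_forall fun n => (hFm n).aestronglyMeasurable)
      (Eventually.of_forall fun n => Eventually.of_forall fun s _ => hg _)
      intervalIntegrable_const (Eventually.of_forall fun s hs => ?_)
    rw [Set.uIoc_of_le ht'.le] at hs
    have hs0 : 0 ≤ s / t := div_nonneg hs.1.le ht'.le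
    have hcast : ∀ n : ℕ, (((⌈s * n / t⌉₊ : ℕ) * (t / n) : ℝ≥0) : ℝ) = t * (⌈s / t * n⌉₊ / n) :=
      fun n => by
        push_cast
        rw [div_mul_eq_mul_div]
        ring
    have h1 : Tendsto (fun n : ℕ => ((⌈s * n / t⌉₊ : ℕ) * (t / n) : ℝ≥0)) atTop
        (𝓝[≥] s.toNNReal) := by
      refine tendsto_nhdsWithin_iff.2 ⟨?_, ?_⟩
      · rw [← NNReal.tendsto_coe, Real.coe_toNNReal s hs.1.le]
        simp only [hcast]
        have h2 := ((tendsto_nat_ceil_mul_div_atTop hs0).comp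
          (tendsto_natCast_atTop_atTop (R := ℝ))).const_mul (t : ℝ)
        rw [mul_div_cancel₀ _ ht'.ne'] at h2
        exact h2
      · filter_upwards [eventually_gt_atTop 0] with n hn
        have hn' : (0 : ℝ) < n := by exact_mod_cast hn
        rw [Set.mem_Ici, Real.toNNReal_le_iff_le_coe, hcast]
        have h3 := Nat.le_ceil (s / t * n)
        calc s = t * (s / t * n / n) := by field_simp
          _ ≤ _ := by gcongr
    refine tendsto_const_nhds.congr' ?_
    filter_upwards [h1.eventually (hx s.toNNReal)] with n hn
    simp only [F, hn]
  refine hlim.congr' ?_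
  filter_upwards [eventually_gt_atTop 0] with n hn
  have hn' : (0 : ℝ) < n := by exact_mod_cast hn
  let p : ℕ → ℝ := fun k => k * (t / n)
  have hp : ∀ k, p k ≤ p (k + 1) := fun k => by simp only [p]; push_cast; gcongr; linarith
  have hconst : ∀ k, ∀ s ∈ Set.uIoc (p k) (p (k + 1)), F n s = g (x ((k + 1 : ℕ) * (t / n))) :=
    fun k s hs => by
      rw [Set.uIoc_of_le (hp k)] at hs
      have h1 : ⌈s * n / t⌉₊ = k + 1 := by
        rw [Nat.ceil_eq_iff (Nat.succ_ne_zero k)]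
        obtain ⟨h2, h3⟩ := hs
        simp only [p] at h2 h3
        constructor
        · rw [lt_div_iff₀ ht', Nat.succ_sub_one]
          rw [← mul_div_assoc, div_lt_iff₀ hn'] at h2
          exact h2
        · rw [div_le_iff₀ ht']
          rw [← mul_div_assoc, le_div_iff₀ hn'] at h3
          exact h3
      simp only [F, h1]
  have hint : ∀ k < n, IntervalIntegrable (F n) volume (p k) (p (k + 1)) := fun k _ =>
    (intervalIntegrable_const (c := g (x ((k + 1 : ℕ) * (t / n))))).congr
      fun s hs => (hconst k s hs).symm
  have hsum := intervalIntegral.sum_integral_adjacent_intervals hint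
  have hp0 : p 0 = 0 := by simp [p]
  have hpn : p n = t := by simp only [p]; field_simp
  rw [hp0, hpn] at hsum
  rw [← hsum]
  refine Finset.sum_congr rfl fun k _ => ?_
  rw [intervalIntegral.integral_congr_ae (Eventually.of_forall (hconst k)),
    intervalIntegral.integral_const, smul_eq_mul]
  congr 1
  simp only [p]
  push_cast
  ring

variable {E : Type*} [Countable E] [MeasurableSpace E] [DiscreteMeasurableSpace E]
  {P : ℝ≥0 → E → E → ℝ} {π : Measure E} [IsProbabilityMeasure π]
  {Ω : Type*} [MeasurableSpace Ω] {μ : Measure Ω} [IsProbabilityMeasure μ] {X : ℝ≥0 → Ω → E}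

/-- A sub-Gaussian bound for the exponential moments of a centred additive functional of a
stationary chain with a spectral gap. -/
lemma lintegral_exp_additive_le {Q : E → E → ℝ} (hQb : UniformlyBounded Q)
    (hP : IsQProcess Q P) (hπ : IsInvariant P π) (hpos : ∀ i, 0 < π.real {i}) {l : ℝ} (hl0 : 0 < l)
    (hl : (l : EReal) ≤ spectralGap P π) (hX : IsMarkovChain P π μ X) {V : E → ℝ} {a b : ℝ}
    (hV : ∀ i, V i ∈ Set.Icc a b) (hV0 : ∫ i, V i ∂π = 0) {t : ℝ≥0} (ht : 0 < t) :
    AEMeasurable (fun ω => ENNReal.ofReal (Real.exp (∫ s in (0 : ℝ)..t, V (X s.toNNReal ω)))) μ ∧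
    ∫⁻ ω, ENNReal.ofReal (Real.exp (∫ s in (0 : ℝ)..t, V (X s.toNNReal ω))) ∂μ ≤
      ENNReal.ofReal (Real.exp (t * ((b - a) ^ 2 / (4 * l)))) := by
  have hT := hP.isTransitionFunction
  obtain ⟨K, hK⟩ := exists_integral_iterate_feynmanKacStep_le hQb hP hπ hpos hl0 hl hV hV0
  set L := (b - a) ^ 2 / (4 * l)
  let f : ℕ → Ω → ℝ≥0∞ := fun n ω => ENNReal.ofReal
    (Real.exp (∑ k ∈ Finset.range n, ((t / n : ℝ≥0) : ℝ) * V (X ((k + 1 : ℕ) * (t / n)) ω)))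
  have hVM : ∀ i, |V i| ≤ max |a| |b| := fun i => abs_le_max_abs_abs (hV i).1 (hV i).2
  have hlim : ∀ᵐ ω ∂μ, Tendsto (fun n => f n ω) atTop
      (𝓝 (ENNReal.ofReal (Real.exp (∫ s in (0 : ℝ)..t, V (X s.toNNReal ω))))) := by
    filter_upwards [hX.right_continuous] with ω hω
    exact ((ENNReal.continuous_ofReal.comp Real.continuous_exp).tendsto _).comp
      (tendsto_riemann_sum_of_right_continuous hω hVM t ht)
  have hVX : ∀ s, Measurable fun ω => V (X s ω) := fun s =>
    Measurable.of_discrete.comp (hX.measurable s)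
  have hfm : ∀ n, Measurable (f n) := fun n =>
    ENNReal.measurable_ofReal.comp (Real.measurable_exp.comp
      (Finset.measurable_fun_sum _ fun k _ => (hVX _).const_mul _))
  refine ⟨aemeasurable_of_tendsto_metrizable_ae atTop (fun n => (hfm n).aemeasurable) hlim, ?_⟩
  have hbound : ∀ᶠ n : ℕ in atTop, ∫⁻ ω, f n ω ∂μ ≤
      ENNReal.ofReal (Real.exp (t * L + K * t ^ 2 / n)) := by
    obtain ⟨N, hN⟩ := exists_nat_ge t
    filter_upwards [eventually_ge_atTop N, eventually_gt_atTop 0] with n hnN hn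
    have hn' : (0 : ℝ) < n := by exact_mod_cast hn
    have hδ : t / n ≤ 1 := by
      refine div_le_one_of_le₀ (hN.trans ?_) zero_le
      exact_mod_cast hnN
    have h1 := hX.lintegral_prod_exp hT hπ hpos hV (t / n) n (memLp_const (1 : ℝ))
      (fun _ => zero_le_one)
    have h2 : ∫⁻ ω, f n ω ∂μ =
        ∫⁻ i, ENNReal.ofReal (((feynmanKacStep P V (t / n))^[n] fun _ => 1) i) ∂π := by
      rw [← h1]
      refine lintegral_congr fun ω => ?_
      simp only [f, Real.exp_sum, ENNReal.ofReal_one, mul_one]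
      exact ENNReal.ofReal_prod_of_nonneg fun k _ => (Real.exp_pos _).le
    have h3 : ∀ (m : ℕ) (ψ : E → ℝ), (∀ i, 0 ≤ ψ i) →
        ∀ i, 0 ≤ ((feynmanKacStep P V (t / n))^[m] ψ) i := fun m => by
      induction m with
      | zero => exact fun ψ hψ => hψ
      | succ m ih => exact fun ψ hψ => ih _ (feynmanKacStep_nonneg hT hψ _)
    have hu := memLp_iterate_feynmanKacStep hT hπ hpos hV (memLp_const (1 : ℝ)) (t / n) n
    rw [h2, ← ofReal_integral_eq_lintegral_ofReal (hu.integrable (by norm_num))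
      (Eventually.of_forall (h3 n _ fun _ => zero_le_one))]
    refine ENNReal.ofReal_le_ofReal ((hK _ hδ n).trans_eq ?_)
    congr 1
    push_cast
    field_simp
  have hz : Tendsto (fun n : ℕ => ENNReal.ofReal (Real.exp (t * L + K * t ^ 2 / n))) atTop
      (𝓝 (ENNReal.ofReal (Real.exp (t * L)))) := by
    have h1 := (tendsto_const_div_atTop_nhds_zero_nat (K * (t : ℝ) ^ 2)).const_add (t * L)
    rw [add_zero] at h1
    exact ((ENNReal.continuous_ofReal.comp Real.continuous_exp).tendsto _).comp h1
  -- Fatou's lemma is enough, since only an upper bound is wanted.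
  calc _ = ∫⁻ ω, liminf (fun n => f n ω) atTop ∂μ :=
        lintegral_congr_ae (hlim.mono fun ω hω => hω.liminf_eq.symm)
    _ ≤ liminf (fun n => ∫⁻ ω, f n ω ∂μ) atTop := lintegral_liminf_le hfm
    _ ≤ liminf (fun n : ℕ => ENNReal.ofReal (Real.exp (t * L + K * t ^ 2 / n))) atTop :=
        liminf_le_liminf hbound
    _ = _ := hz.liminf_eq

lemma measure_ge_le_exp {Q : E → E → ℝ} (hQb : UniformlyBounded Q)
    (hP : IsQProcess Q P) (hπ : IsInvariant P π) (hpos : ∀ i, 0 < π.real {i}) {l : ℝ} (hl0 : 0 < l)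
    (hl : (l : EReal) ≤ spectralGap P π) (hX : IsMarkovChain P π μ X) {a b : ℝ} (hab : a < b)
    {g : E → ℝ} (hg : ∀ i, g i ∈ Set.Icc a b) {t ε : ℝ} (ht : 0 < t) (hε : 0 < ε) :
    μ {ω | ε ≤ (1 / t) * (∫ s in (0 : ℝ)..t, g (X s.toNNReal ω)) - ∫ i, g i ∂π} ≤
      ENNReal.ofReal (Real.exp (-(l * (t * ε ^ 2 / (b - a) ^ 2)))) := by
  lift t to ℝ≥0 using ht.le
  have ht0 : 0 < t := by exact_mod_cast ht
  have hba : 0 < b - a := sub_pos.2 hab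
  set m := ∫ i, g i ∂π with hm
  -- The minimizer of `s² (b - a)² / (4 l) - s ε`, with minimum `-l ε² / (b - a)²`.
  set s := 2 * l * ε / (b - a) ^ 2 with hs
  have hs0 : 0 < s := by positivity
  let V : E → ℝ := fun i => s * (g i - m)
  have hgi : Integrable g π :=
    Integrable.of_mem_Icc a b Measurable.of_discrete.aemeasurable (Eventually.of_forall hg)
  have hV : ∀ i, V i ∈ Set.Icc (s * (a - m)) (s * (b - m)) := fun i => by
    obtain ⟨h1, h2⟩ := hg i
    constructor <;> simp only [V] <;> gcongr
  have hV0 : ∫ i, V i ∂π = 0 := by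
    simp only [V]
    rw [integral_const_mul, integral_sub hgi (integrable_const _)]
    simp [hm]
  obtain ⟨hmeas, hexp⟩ := lintegral_exp_additive_le hQb hP hπ hpos hl0 hl hX hV hV0 ht0
  have hgM : ∀ i, |g i| ≤ max |a| |b| := fun i => abs_le_max_abs_abs (hg i).1 (hg i).2
  have hVM : ∀ i, |V i| ≤ s * (max |a| |b| + |m|) := fun i => by
    rw [abs_mul, abs_of_pos hs0]
    have := abs_sub (g i) m
    have := hgM i
    gcongr
    linarith
  have hsub : ∀ᵐ ω ∂μ, ε ≤ (1 / t) * (∫ r in (0 : ℝ)..t, g (X r.toNNReal ω)) - m →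
      ENNReal.ofReal (Real.exp (s * ε * t)) ≤
        ENNReal.ofReal (Real.exp (∫ r in (0 : ℝ)..t, V (X r.toNNReal ω))) := by
    filter_upwards [hX.right_continuous] with ω hω h
    have h1 := tendsto_riemann_sum_of_right_continuous hω hVM t ht0
    have h2 := tendsto_riemann_sum_of_right_continuous hω hgM t ht0
    -- Linearity is read off from the Riemann sums, with no appeal to integrability of the path.
    have h3 : ∫ r in (0 : ℝ)..t, V (X r.toNNReal ω) =
        s * (∫ r in (0 : ℝ)..t, g (X r.toNNReal ω)) - s * m * t := by
      refine tendsto_nhds_unique h1 (((h2.const_mul s).sub_const (s * m * t)).congr' ?_)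
      filter_upwards [eventually_gt_atTop 0] with n hn
      have hn' : (n : ℝ) ≠ 0 := by exact_mod_cast hn.ne'
      simp only [V, mul_sub, Finset.sum_sub_distrib, Finset.mul_sum, Finset.sum_const,
        Finset.card_range, nsmul_eq_mul]
      congr 1
      · exact Finset.sum_congr rfl fun k _ => by ring
      · push_cast
        field_simp
    refine ENNReal.ofReal_le_ofReal (Real.exp_le_exp.2 ?_)
    rw [h3]
    have h4 := mul_le_mul_of_nonneg_left h (mul_pos hs0 ht).le
    have h5 : s * t * (1 / t * (∫ r in (0 : ℝ)..t, g (X r.toNNReal ω)) - m) =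
        s * (∫ r in (0 : ℝ)..t, g (X r.toNNReal ω)) - s * m * t := by
      field_simp
    linarith
  have hmarkov := (mul_meas_ge_le_lintegral₀ hmeas (ENNReal.ofReal (Real.exp (s * ε * t)))).trans hexp
  have hc0 : ENNReal.ofReal (Real.exp (s * ε * t)) ≠ 0 :=
    (ENNReal.ofReal_pos.2 (Real.exp_pos _)).ne'
  refine (measure_mono_ae hsub).trans ?_
  rw [mul_comm, ← ENNReal.le_div_iff_mul_le (Or.inl hc0) (Or.inl ENNReal.ofReal_ne_top),
    ← ENNReal.ofReal_div_of_pos (Real.exp_pos _), ← Real.exp_sub] at hmarkov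
  refine hmarkov.trans_eq ?_
  congr 2
  rw [hs]
  field_simp
  ring

end HoeffdingCTMC

theorem mainTheorem4 {E : Type*} [Countable E] [MeasurableSpace E] [DiscreteMeasurableSpace E]
    (Q : E → E → ℝ) (hQ : HoeffdingCTMC.IsQMatrix Q) (hQb : HoeffdingCTMC.UniformlyBounded Q)
    (P : ℝ≥0 → E → E → ℝ) (hP : HoeffdingCTMC.IsQProcess Q P)
    (hirr : HoeffdingCTMC.IsIrreducible P)
    (π : Measure E) [IsProbabilityMeasure π] (hπ : HoeffdingCTMC.IsInvariant P π)
    (hgap : 0 < HoeffdingCTMC.spectralGap P π)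
    {Ω : Type*} [MeasurableSpace Ω] (μ : Measure Ω) [IsProbabilityMeasure μ]
    (X : ℝ≥0 → Ω → E) (hX : HoeffdingCTMC.IsMarkovChain P π μ X)
    (a b : ℝ) (hab : a < b) (g : E → ℝ) (hg : ∀ i, g i ∈ Set.Icc a b)
    (t ε : ℝ) (ht : 0 < t) (hε : 0 < ε) :
    μ {ω | ε ≤ (1 / t) * (∫ s in (0 : ℝ)..t, g (X s.toNNReal ω)) - ∫ i, g i ∂π} ≤
      EReal.exp (-(HoeffdingCTMC.spectralGap P π *
        ((t * ε ^ 2 / (b - a) ^ 2 : ℝ) : EReal))) := by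
  have hpos := hπ.real_singleton_pos hP.isTransitionFunction hirr
  have hba : 0 < b - a := sub_pos.2 hab
  have hc : 0 < t * ε ^ 2 / (b - a) ^ 2 := by positivity
  -- Every real `l` up to the gap is allowed: a finite gap is taken as `l` itself, and an infinite
  -- one is reached by letting `l → ∞`.
  have key : ∀ l : ℝ, 0 < l → (l : EReal) ≤ HoeffdingCTMC.spectralGap P π → _ := fun l hl0 hl =>
    HoeffdingCTMC.measure_ge_le_exp hQb hP hπ hpos hl0 hl hX hab hg ht hε
  generalize HoeffdingCTMC.spectralGap P π = G at hgap key
  induction G with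
  | bot => simp at hgap
  | coe l =>
    rw [← EReal.coe_mul, ← EReal.coe_neg, EReal.exp_coe]
    exact key l (by exact_mod_cast hgap) le_rfl
  | top =>
    rw [EReal.top_mul_coe_of_pos hc, EReal.neg_top, EReal.exp_bot]
    have h1 : Tendsto (fun l : ℝ => ENNReal.ofReal (Real.exp (-(l * (t * ε ^ 2 / (b - a) ^ 2)))))
        atTop (𝓝 0) := by
      have h2 : Tendsto (fun l : ℝ => Real.exp (-(l * (t * ε ^ 2 / (b - a) ^ 2)))) atTop (𝓝 0) :=
        Real.tendsto_exp_neg_atTop_nhds_zero.comp (tendsto_id.atTop_mul_const hc)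
      simpa using ENNReal.tendsto_ofReal h2
    refine ge_of_tendsto h1 ?_
    filter_upwards [eventually_gt_atTop 0] with l hl0
    exact key l hl0 le_top
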